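/- Throughout, $X$ is a complex Banach space and $B(X)$ is the algebra of bounded linear operators on $X$. Definitions. For a non-empty compact set $\sigma\subset\mathbb C$, a function $f:\sigma\to\mathbb C$ and a piecewise linear curve $\gamma:[0,1]\to\mathbb C$, let $\operatorname{cvar}(f,\gamma)$ be the supremum of the sums $\sum_i |f(\gamma(s_{i+1}))-f(\gamma(s_i))|$ over all finite sequences $s_0\le s_1\le\dots\le s_n$ in $[0,1]$ with all $\gamma(s_i)\in\sigma$ (zero if there are none). A parameter $t\in[0,1]$ is an entry point of $\gamma$ on a line $\ell$ if $\gamma(t)\in\ell$ and either $t=0$ or there are $s<t$ in $[0,1]$ arbitrarily close to $t$ with $\gamma(s)\notin\ell$. Let $\operatorname{vf}(\gamma)$ be the maximal number of entry points of $\gamma$ on a line, and $\rho(\gamma)=1/\operatorname{vf}(\gamma)$. Put $\|f\|_{BV(\sigma)}=\|f\|_\infty+\sup_\gamma \operatorname{cvar}(f,\gamma)\,\rho(\gamma)$, the supremum being over all piecewise linear curves; $BV(\sigma)$ is the algebra of those $f$ for which this is finite, and $AC(\sigma)$ is the closure in $BV(\sigma)$ of the polynomials in $z$ and $\overline z$.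 An operator $T\in B(X)$ is an $AC(\sigma)$ operator if there is a bounded unital algebra homomorphism $\Psi:AC(\sigma)\to B(X)$ that maps the identity function $z\mapsto z$ of $\sigma$ to $T$. An operator $A\in B(X)$ is well-bounded if there are a compact interval $[a,b]\subset\mathbb R$ and a constant $K$ with $\|p(A)\|\le K\bigl(|p(b)|+\operatorname{var}_{[a,b]}p\bigr)$ for all complex polynomials $p$. A splitting of $S\in B(X)$ is a pair $(A,B)$ of commuting well-bounded operators with $S=A+iB$. Theorem. Let $\sigma\subset\mathbb C$ be compact and non-empty, let $T\in B(X)$ be a compact $AC(\sigma)$ operator with splitting $T=A+iB$, and let $\omega=\alpha+i\beta$ with $\alpha,\beta\in\mathbb R$. Then $$\omega T=(\alpha A-\beta B)+i(\alpha B+\beta A)$$ is a splitting of $\omega T$, and it is the only one: if $U,V\in B(X)$ are commuting well-bounded operators with $\omega T=U+iV$, then $U=\alpha A-\beta B$ and $V=\alpha B+\beta A$. -/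

import Mathlib

open scoped ENNReal NNReal

/-- `γ`, restricted to `[0,1]`, is a (continuous) piecewise linear curve in the plane: `[0,1]` is
cut at `0 = t 0 ≤ t 1 ≤ … ≤ t n = 1`, and `γ` is affine on each closed piece. -/
def IsPiecewiseLinearCurve (γ : ℝ → ℂ) : Prop :=
  ∃ (n : ℕ) (t : ℕ → ℝ), Monotone t ∧ t 0 = 0 ∧ t n = 1 ∧
    ∀ i < n, ∃ c d : ℂ, ∀ s ∈ Set.Icc (t i) (t (i + 1)), γ s = c + s * d

/-- The lines of the plane are the sets `Re (w z) = c` with `w ≠ 0`, `c` real. -/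
def planeLine (w : ℂ) (c : ℝ) : Set ℂ := {z | (w * z).re = c}

/-- The (parameters of the) entry points of the curve `γ` on `ℓ`: either `t = 0`, or the curve is
off `ℓ` at times `s < t` arbitrarily close to `t`. -/
def entryPoints (γ : ℝ → ℂ) (ℓ : Set ℂ) : Set ℝ :=
  {t | t ∈ Set.Icc (0 : ℝ) 1 ∧ γ t ∈ ℓ ∧
    (t = 0 ∨ ∀ ε > 0, ∃ s ∈ Set.Icc (0 : ℝ) 1, t - ε < s ∧ s < t ∧ γ s ∉ ℓ)}

/-- The variation factor of `γ`: the maximal number of entry points of `γ` on a line. -/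
noncomputable def variationFactor (γ : ℝ → ℂ) : ℕ∞ :=
  ⨆ (w : ℂ) (_ : w ≠ 0) (c : ℝ), (entryPoints γ (planeLine w c)).encard

/-- The variation of `f : σ → ℂ` along the curve `γ`: the supremum of
`∑ |f (γ s_{i+1}) - f (γ s_i)|` over `s_0 ≤ s_1 ≤ … ≤ s_n` in `[0,1]` with all `γ s_i ∈ σ`. -/
noncomputable def curveVariation {σ : Set ℂ} (f : σ → ℂ) (γ : ℝ → ℂ) : ℝ≥0∞ :=
  eVariationOn (fun s : {s : ℝ // s ∈ Set.Icc (0 : ℝ) 1 ∧ γ s ∈ σ} => f ⟨γ s, s.2.2⟩) Set.univ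

/-- The two-dimensional variation `sup_γ cvar(f, γ) ρ(γ)` with `ρ(γ) = 1 / vf(γ)`, over all
piecewise linear curves (for which `1 ≤ vf(γ) < ∞`). -/
noncomputable def planeVariation {σ : Set ℂ} (f : σ → ℂ) : ℝ≥0∞ :=
  ⨆ (γ : ℝ → ℂ) (_ : IsPiecewiseLinearCurve γ),
    curveVariation f γ * ((variationFactor γ : ℕ∞) : ℝ≥0∞)⁻¹

/-- The norm of `BV(σ)`, with value `∞` outside `BV(σ)`. -/
noncomputable def bvNorm {σ : Set ℂ} (f : σ → ℂ) : ℝ≥0∞ :=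
  (⨆ z, ‖f z‖ₑ) + planeVariation f

section BVHelpers

variable {σ : Set ℂ}

lemma enorm_le_bvSup (f : σ → ℂ) (z : σ) : ‖f z‖ₑ ≤ ⨆ z, ‖f z‖ₑ := le_iSup (fun z => ‖f z‖ₑ) z

lemma curveVariation_add_le (f g : σ → ℂ) (γ : ℝ → ℂ) :
    curveVariation (f + g) γ ≤ curveVariation f γ + curveVariation g γ := by
  refine iSup_le fun p => ?_
  refine le_trans ?_ (add_le_add (eVariationOn.sum_le (n := p.1) p.2.2.1 p.2.2.2)
    (eVariationOn.sum_le (n := p.1) p.2.2.1 p.2.2.2))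
  rw [← Finset.sum_add_distrib]
  exact Finset.sum_le_sum fun i _ => edist_add_add_le _ _ _ _

lemma curveVariation_mul_le (f g : σ → ℂ) (γ : ℝ → ℂ) :
    curveVariation (f * g) γ ≤
      (⨆ z, ‖f z‖ₑ) * curveVariation g γ + (⨆ z, ‖g z‖ₑ) * curveVariation f γ := by
  refine iSup_le fun p => ?_
  refine le_trans ?_ (add_le_add
    (mul_le_mul_right (eVariationOn.sum_le (n := p.1) p.2.2.1 p.2.2.2) _)
    (mul_le_mul_right (eVariationOn.sum_le (n := p.1) p.2.2.1 p.2.2.2) _))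
  rw [Finset.mul_sum, Finset.mul_sum, ← Finset.sum_add_distrib]
  refine Finset.sum_le_sum fun i _ => ?_
  simp only [Pi.mul_apply, edist_eq_enorm_sub]
  generalize (⟨γ (p.2.1 (i + 1)), _⟩ : σ) = a
  generalize (⟨γ (p.2.1 i), _⟩ : σ) = b
  have h : f a * g a - f b * g b = f a * (g a - g b) + g b * (f a - f b) := by ring
  rw [h]
  refine (enorm_add_le _ _).trans ?_
  rw [enorm_mul, enorm_mul]
  exact add_le_add (mul_le_mul_left (enorm_le_bvSup f a) _)
    (mul_le_mul_left (enorm_le_bvSup g b) _)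

lemma planeVariation_add_le (f g : σ → ℂ) :
    planeVariation (f + g) ≤ planeVariation f + planeVariation g := by
  refine iSup₂_le fun γ hγ => ?_
  refine (mul_le_mul_left (curveVariation_add_le f g γ) _).trans ?_
  rw [add_mul]
  exact add_le_add
    (le_iSup₂ (f := fun γ (_ : IsPiecewiseLinearCurve γ) =>
      curveVariation f γ * ((variationFactor γ : ℕ∞) : ℝ≥0∞)⁻¹) γ hγ)
    (le_iSup₂ (f := fun γ (_ : IsPiecewiseLinearCurve γ) =>
      curveVariation g γ * ((variationFactor γ : ℕ∞) : ℝ≥0∞)⁻¹) γ hγ)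

lemma planeVariation_mul_le (f g : σ → ℂ) :
    planeVariation (f * g) ≤
      (⨆ z, ‖f z‖ₑ) * planeVariation g + (⨆ z, ‖g z‖ₑ) * planeVariation f := by
  refine iSup₂_le fun γ hγ => ?_
  refine (mul_le_mul_left (curveVariation_mul_le f g γ) _).trans ?_
  rw [add_mul, mul_assoc, mul_assoc]
  exact add_le_add
    (mul_le_mul_right (le_iSup₂ (f := fun γ (_ : IsPiecewiseLinearCurve γ) =>
      curveVariation g γ * ((variationFactor γ : ℕ∞) : ℝ≥0∞)⁻¹) γ hγ) _)
    (mul_le_mul_right (le_iSup₂ (f := fun γ (_ : IsPiecewiseLinearCurve γ) =>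
      curveVariation f γ * ((variationFactor γ : ℕ∞) : ℝ≥0∞)⁻¹) γ hγ) _)

lemma bvNorm_add_le (f g : σ → ℂ) : bvNorm (f + g) ≤ bvNorm f + bvNorm g := by
  have h1 : (⨆ z, ‖(f + g) z‖ₑ) ≤ (⨆ z, ‖f z‖ₑ) + ⨆ z, ‖g z‖ₑ :=
    iSup_le fun z => (enorm_add_le _ _).trans
      (add_le_add (enorm_le_bvSup f z) (enorm_le_bvSup g z))
  refine (add_le_add h1 (planeVariation_add_le f g)).trans (le_of_eq ?_)
  unfold bvNorm
  ring

lemma bvNorm_mul_le (f g : σ → ℂ) : bvNorm (f * g) ≤ bvNorm f * bvNorm g := by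
  have h1 : (⨆ z, ‖(f * g) z‖ₑ) ≤ (⨆ z, ‖f z‖ₑ) * ⨆ z, ‖g z‖ₑ :=
    iSup_le fun z => by
      rw [Pi.mul_apply, enorm_mul]
      exact mul_le_mul' (enorm_le_bvSup f z) (enorm_le_bvSup g z)
  refine (add_le_add h1 (planeVariation_mul_le f g)).trans ?_
  unfold bvNorm
  generalize (⨆ z, ‖f z‖ₑ) = a
  generalize (⨆ z, ‖g z‖ₑ) = b
  generalize planeVariation f = c
  generalize planeVariation g = d
  calc a * b + (a * d + b * c) ≤ a * b + (a * d + b * c) + c * d := le_self_add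
    _ = (a + c) * (b + d) := by ring

lemma bvNorm_const_ne_top (c : ℂ) : bvNorm (fun _ : σ => c) ≠ ⊤ := by
  have h1 : (⨆ _ : σ, ‖c‖ₑ) ≤ ‖c‖ₑ := iSup_le fun _ => le_rfl
  have h2 : planeVariation (fun _ : σ => c) = 0 := by
    refine le_antisymm (iSup₂_le fun γ _ => ?_) bot_le
    have : curveVariation (fun _ : σ => c) γ = 0 :=
      eVariationOn.constant_on (Set.subsingleton_of_forall_eq c (by rintro _ ⟨_, _, rfl⟩; rfl))
    rw [this, zero_mul]
  unfold bvNorm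
  rw [h2, add_zero]
  exact (h1.trans_lt enorm_lt_top).ne

lemma bvNorm_zero : bvNorm (0 : σ → ℂ) = 0 := by
  have h2 : planeVariation (0 : σ → ℂ) = 0 := by
    refine le_antisymm (iSup₂_le fun γ _ => ?_) bot_le
    have : curveVariation (0 : σ → ℂ) γ = 0 :=
      eVariationOn.constant_on (Set.subsingleton_of_forall_eq 0 (by rintro _ ⟨_, _, rfl⟩; rfl))
    rw [this, zero_mul]
  unfold bvNorm
  rw [h2, add_zero]
  simp

end BVHelpers

/-- The algebra `BV(σ)` of functions of bounded variation on `σ`. -/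
noncomputable def BV (σ : Set ℂ) : Subalgebra ℂ (σ → ℂ) where
  carrier := {f | bvNorm f ≠ ⊤}
  mul_mem' {f g} hf hg := ne_top_of_le_ne_top (ENNReal.mul_ne_top hf hg) (bvNorm_mul_le f g)
  add_mem' {f g} hf hg := ne_top_of_le_ne_top (ENNReal.add_ne_top.2 ⟨hf, hg⟩) (bvNorm_add_le f g)
  algebraMap_mem' c := bvNorm_const_ne_top c

/-- The polynomials in `z` and `z̄`, as functions on `σ`. -/
noncomputable def planePolynomials (σ : Set ℂ) : Subalgebra ℂ (σ → ℂ) :=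
  Algebra.adjoin ℂ {fun z : σ => (z : ℂ), fun z : σ => (starRingEnd ℂ) (z : ℂ)}

/-- The algebra `AC(σ)` of absolutely continuous functions on `σ`: the closure in `BV(σ)` of the
polynomials in `z` and `z̄`. -/
noncomputable def AC (σ : Set ℂ) : Subalgebra ℂ (σ → ℂ) where
  carrier := {f | f ∈ BV σ ∧ ∀ ε > 0, ∃ p ∈ planePolynomials σ, bvNorm (f - p) < ε}
  algebraMap_mem' c := ⟨(BV σ).algebraMap_mem c, fun ε hε =>
    ⟨_, (planePolynomials σ).algebraMap_mem c, by rwa [sub_self, bvNorm_zero]⟩⟩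
  add_mem' := by
    rintro f g ⟨hf, hf'⟩ ⟨hg, hg'⟩
    refine ⟨(BV σ).add_mem hf hg, fun ε hε => ?_⟩
    obtain ⟨p, hp, hfp⟩ := hf' (ε / 2) (ENNReal.half_pos hε.ne')
    obtain ⟨q, hq, hgq⟩ := hg' (ε / 2) (ENNReal.half_pos hε.ne')
    refine ⟨p + q, (planePolynomials σ).add_mem hp hq, ?_⟩
    rw [add_sub_add_comm]
    refine (bvNorm_add_le _ _).trans_lt ?_
    simpa using ENNReal.add_lt_add hfp hgq
  mul_mem' := by
    rintro f g ⟨hf, hf'⟩ ⟨hg, hg'⟩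
    refine ⟨(BV σ).mul_mem hf hg, fun ε hε => ?_⟩
    have key : ∀ a : ℝ≥0∞, a ≠ ⊤ → ∃ δ > 0, a * δ < ε / 2 := fun a ha => by
      obtain ⟨δ, hδ, h⟩ := ENNReal.exists_nnreal_pos_mul_lt ha (ENNReal.half_pos hε.ne').ne'
      exact ⟨δ, by exact_mod_cast hδ, by rwa [mul_comm]⟩
    obtain ⟨δ, hδ, h1⟩ := key _ hf
    obtain ⟨q, hq, hgq⟩ := hg' (min δ 1) (lt_min hδ one_pos)
    have hqtop : bvNorm q ≠ ⊤ := by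
      have h : q = g + (-1 : σ → ℂ) * (g - q) := by ring
      have h' : bvNorm (-1 : σ → ℂ) ≠ ⊤ := bvNorm_const_ne_top (-1)
      rw [h]
      exact (BV σ).add_mem hg ((BV σ).mul_mem h' (hgq.trans_le le_top).ne)
    obtain ⟨δ', hδ', h2⟩ := key _ hqtop
    obtain ⟨p, hp, hfp⟩ := hf' δ' hδ'
    refine ⟨p * q, (planePolynomials σ).mul_mem hp hq, ?_⟩
    have h : f * g - p * q = f * (g - q) + q * (f - p) := by ring
    rw [h]
    refine (bvNorm_add_le _ _).trans_lt ?_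
    have e1 : bvNorm (f * (g - q)) < ε / 2 :=
      ((bvNorm_mul_le _ _).trans
        (mul_le_mul_right (hgq.le.trans (min_le_left _ _)) _)).trans_lt h1
    have e2 : bvNorm (q * (f - p)) < ε / 2 :=
      ((bvNorm_mul_le _ _).trans (mul_le_mul_right hfp.le _)).trans_lt h2
    simpa using ENNReal.add_lt_add e1 e2

/-- `T` admits an `AC(σ)` functional calculus: a bounded unital algebra homomorphism
`AC(σ) → B(X)` that sends the identity function of `σ` to `T`. -/
def IsACOperator {X : Type*} [NormedAddCommGroup X] [NormedSpace ℂ X]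
    (σ : Set ℂ) (T : X →L[ℂ] X) : Prop :=
  ∃ Ψ : AC σ →ₐ[ℂ] (X →L[ℂ] X),
    (∃ K : ℝ≥0, ∀ f : AC σ, ‖Ψ f‖ₑ ≤ K * bvNorm (f : σ → ℂ)) ∧
    ∃ idσ : AC σ, (∀ z : σ, (idσ : σ → ℂ) z = z) ∧ Ψ idσ = T

/-- `A` is well-bounded: for some compact interval `[a,b]` and some constant `K`,
`‖p(A)‖ ≤ K (|p(b)| + var_{[a,b]} p)` for all complex polynomials `p`. -/
def IsWellBounded {X : Type*} [NormedAddCommGroup X] [NormedSpace ℂ X] (A : X →L[ℂ] X) : Prop :=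
  ∃ (a b : ℝ) (K : ℝ≥0), a ≤ b ∧ ∀ p : Polynomial ℂ,
    ‖Polynomial.aeval A p‖ₑ ≤
      K * (‖p.eval (b : ℂ)‖ₑ + eVariationOn (fun t : ℝ => p.eval (t : ℂ)) (Set.Icc a b))

/-- `T = A + iB` is a splitting of `T` into commuting well-bounded real and imaginary parts. -/
structure IsSplitting {X : Type*} [NormedAddCommGroup X] [NormedSpace ℂ X]
    (T A B : X →L[ℂ] X) : Prop where
  wellBounded_re : IsWellBounded A
  wellBounded_im : IsWellBounded B
  commute : Commute A B
  eq_add : T = A + Complex.I • B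

/-!
The proof rests on two facts.

*Existence.* A curve with at most `N` entry points on each line crosses every level of
`z ↦ Re (w z)` at most `N` times, since each crossing produces an entry point. Hence
`f (Re (w z))` has two-dimensional variation at most the one-dimensional variation of `f`
(`planeVariation_comp_re_le`), and the `AC(σ)` calculus `Ψ` of `T` maps each real coordinate
`Re (w z)` to a well-bounded operator (`isWellBounded_apply_reCoord`). In particular `Ψ(Re z)` and
`Ψ(Im z)` form a splitting of `T`, and `Ψ(Re (ω z))` and `Ψ(Im (ω z))` form one of `ω T`.

*Uniqueness.* A compact operator `T` has at most one splitting (`IsSplitting.unique`). This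
identifies the given `A` and `B` with `Ψ(Re z)` and `Ψ(Im z)`, which proves the first claim, and
applied to `ω T` it is the second claim.

For uniqueness let `T = A + iB = C + iD`. The polynomial calculus of `A` extends to `C¹` functions
by continuity in the variation norm (`IsCalc`). As `A² + B² = T (A - iB)` is compact, `h(A)` is
compact for every `C¹` function `h` vanishing near `0`: the factor `h / (1 + (x / M)²) ^ k` tends
to `0` in variation, while `(1 + (A / M)²) ^ k` agrees modulo compact operators with
`(1 - (B / M)²) ^ k`, which stays bounded (`IsSplitting.isCompactOperator_of_isCalc`).
So `A` is a limit of operators with range in finite-dimensional spaces `W` that are invariant under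
`A` and `B` and meet `ker A` trivially (`IsSplitting.exists_finiteDimensional_approx`). A
well-bounded operator on a finite-dimensional space is diagonalisable with real eigenvalues
(`IsWellBounded.le_iSup_eigenspace`), so `A` and `C` are both `Re μ` on the finite-dimensional
eigenspace of `T` at any `μ ≠ 0`. Hence `N = A - C` vanishes on each `W`, which gives `N A = 0`
(`IsSplitting.sub_mul_eq_zero`) and from it `A N = 0` (`IsSplitting.mul_sub_eq_zero`). By symmetry
`A` and `C` have the same powers from the second on, so `p(A) - p(C) = p'(0) N` for all
polynomials `p`. Since `p'(0)` can be about `1` while `p` has arbitrarily small variation, `N = 0`.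
-/

/-! ### Variation along curves of functions of one real coordinate -/

lemma IsPiecewiseLinearCurve.continuousOn {γ : ℝ → ℂ} (hγ : IsPiecewiseLinearCurve γ) :
    ContinuousOn γ (Set.Icc 0 1) := by
  obtain ⟨n, t, ht, h0, h1, haff⟩ := hγ
  have key : ∀ m ≤ n, ContinuousOn γ (Set.Icc (t 0) (t m)) := by
    intro m
    induction m with
    | zero => intro _; simp
    | succ m ih =>
      intro hm
      obtain ⟨c, d, hcd⟩ := haff m hm
      rw [← Set.Icc_union_Icc_eq_Icc (ht m.zero_le) (ht m.le_succ)]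
      refine (ih (by omega)).union_of_isClosed ?_ isClosed_Icc isClosed_Icc
      have : Continuous fun s : ℝ => c + s * d := by fun_prop
      exact this.continuousOn.congr hcd
  simpa [h0, h1] using key n le_rfl

/-- If every level is strictly crossed by at most `N` of the steps `u i → u (i + 1)`, then the
total oscillation of `f` along these steps is at most `N` times its variation. -/
lemma sum_edist_le_mul_eVariationOn {E : Type*} [PseudoEMetricSpace E] (f : ℝ → E) {a b : ℝ}
    {u : ℕ → ℝ} {n N : ℕ} (hu : ∀ i, u i ∈ Set.Icc a b)
    (hN : ∀ x, {i ∈ Finset.range n |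
      x ∈ Set.Ioo (min (u i) (u (i + 1))) (max (u i) (u (i + 1)))}.card ≤ N) :
    ∑ i ∈ Finset.range n, edist (f (u (i + 1))) (f (u i)) ≤ N * eVariationOn f (Set.Icc a b) := by
  classical
  -- `x 0 < x 1 < … < x m` is the increasing enumeration of the values `u 0, …, u n`.
  set S : Finset ℝ := (Finset.range (n + 1)).image u with hS
  have hSne : S.Nonempty := ⟨u 0, Finset.mem_image_of_mem u (by simp)⟩
  obtain ⟨m, hm⟩ : ∃ m, S.card = m + 1 := Nat.exists_eq_succ_of_ne_zero hSne.card_pos.ne'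
  set x : ℕ → ℝ := fun k => S.orderEmbOfFin hm ⟨min k m, by omega⟩ with hx
  have hxmono : Monotone x := fun k l hkl => by
    simp only [hx, OrderEmbedding.le_iff_le, Fin.mk_le_mk]
    exact min_le_min_right m hkl
  have hxlt : ∀ k < m, x k < x (k + 1) := fun k hk => by
    simp only [hx, OrderEmbedding.lt_iff_lt, Fin.mk_lt_mk]
    omega
  have hxmem : ∀ k, x k ∈ Set.Icc a b := fun k => by
    have h : x k ∈ S := S.orderEmbOfFin_mem hm _
    obtain ⟨i, -, hi⟩ := Finset.mem_image.1 h
    exact hi ▸ hu i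
  have hκ : ∀ i, ∃ k, i ≤ n → k ≤ m ∧ x k = u i := by
    intro i
    by_cases hi : i ≤ n
    · have h : u i ∈ Set.range (S.orderEmbOfFin hm) := by
        rw [S.range_orderEmbOfFin hm]
        exact Finset.mem_image_of_mem u (by simp; omega)
      obtain ⟨⟨k, hk⟩, h⟩ := h
      refine ⟨k, fun _ => ⟨by omega, ?_⟩⟩
      rw [← h]
      simp only [hx]
      congr 2
      omega
    · exact ⟨0, fun h => absurd h hi⟩
  choose κ hκ using hκ
  set d : ℕ → ℝ≥0∞ := fun k => edist (f (x k)) (f (x (k + 1))) with hd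
  have step : ∀ i ∈ Finset.range n, edist (f (u (i + 1))) (f (u i)) ≤
      ∑ k ∈ Finset.range m,
        if k ∈ Finset.Ico (min (κ i) (κ (i + 1))) (max (κ i) (κ (i + 1))) then d k else 0 := by
    intro i hi
    rw [Finset.mem_range] at hi
    obtain ⟨h1, h2⟩ := hκ i hi.le
    obtain ⟨h3, h4⟩ := hκ (i + 1) hi
    have e : edist (f (u (i + 1))) (f (u i)) =
        edist (f (x (min (κ i) (κ (i + 1))))) (f (x (max (κ i) (κ (i + 1))))) := by
      rcases le_total (κ i) (κ (i + 1)) with h | h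
      · rw [min_eq_left h, max_eq_right h, h2, h4, edist_comm]
      · rw [min_eq_right h, max_eq_left h, h2, h4]
    rw [e, ← Finset.sum_filter]
    refine (edist_le_Ico_sum_edist (fun k => f (x k)) min_le_max).trans
      (Finset.sum_le_sum_of_subset fun k hk => ?_)
    rw [Finset.mem_filter, Finset.mem_range]
    refine ⟨?_, hk⟩
    have := (Finset.mem_Ico.1 hk).2
    omega
  refine (Finset.sum_le_sum step).trans ?_
  rw [Finset.sum_comm]
  have count : ∀ k ∈ Finset.range m, (∑ i ∈ Finset.range n,
      if k ∈ Finset.Ico (min (κ i) (κ (i + 1))) (max (κ i) (κ (i + 1))) then d k else 0) ≤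
      N * d k := by
    intro k hk
    rw [Finset.mem_range] at hk
    rw [← Finset.sum_filter, Finset.sum_const, nsmul_eq_mul]
    gcongr
    -- The midpoint of `(x k, x (k + 1))` is crossed by every step passing over this interval.
    refine le_trans (Finset.card_le_card ?_) (hN ((x k + x (k + 1)) / 2))
    intro i hi
    rw [Finset.mem_filter, Finset.mem_range, Finset.mem_Ico] at hi
    rw [Finset.mem_filter, Finset.mem_range]
    obtain ⟨hin, hlo, hhi⟩ := hi
    have h2 := (hκ i hin.le).2
    have h4 := (hκ (i + 1) hin).2
    rw [← h2, ← h4, ← hxmono.map_min, ← hxmono.map_max]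
    have := hxlt k hk
    exact ⟨hin, by linarith [hxmono hlo], by linarith [hxmono (Nat.succ_le_of_lt hhi)]⟩
  refine (Finset.sum_le_sum count).trans ?_
  rw [← Finset.mul_sum]
  gcongr
  refine le_trans (le_of_eq ?_) (eVariationOn.sum_le (f := f) (n := m) hxmono hxmem)
  exact Finset.sum_congr rfl fun k _ => edist_comm _ _

/-- Between two parameters at which a curve lies on different sides of a line, there is an entry
point on this line. -/
lemma exists_mem_entryPoints {γ : ℝ → ℂ} (hγ : ContinuousOn γ (Set.Icc 0 1)) (w : ℂ) {p q x : ℝ}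
    (hpq : p ≤ q) (hp : p ∈ Set.Icc (0 : ℝ) 1) (hq : q ∈ Set.Icc (0 : ℝ) 1)
    (hx : x ∈ Set.Ioo (min (w * γ p).re (w * γ q).re) (max (w * γ p).re (w * γ q).re)) :
    ∃ t ∈ Set.Ioo p q, t ∈ entryPoints γ (planeLine w x) := by
  have hsub : Set.Icc p q ⊆ Set.Icc 0 1 := Set.Icc_subset_Icc hp.1 hq.2
  have hcont : ContinuousOn (fun s => (w * γ s).re) (Set.Icc p q) :=
    Complex.continuous_re.comp_continuousOn (continuousOn_const.mul (hγ.mono hsub))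
  set Z : Set ℝ := Set.Icc p q ∩ (fun s => (w * γ s).re) ⁻¹' {x} with hZ
  have hZc : IsClosed Z := hcont.preimage_isClosed_of_isClosed isClosed_Icc isClosed_singleton
  have hZne : Z.Nonempty := by
    have h := intermediate_value_uIcc (f := fun s => (w * γ s).re) (a := p) (b := q)
      (by rwa [Set.uIcc_of_le hpq])
    obtain ⟨t, ht, htx⟩ := h ⟨hx.1.le, hx.2.le⟩
    exact ⟨t, by rwa [Set.uIcc_of_le hpq] at ht, htx⟩
  have hZb : BddBelow Z := ⟨p, fun t ht => ht.1.1⟩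
  obtain ⟨⟨hp', hq'⟩, hval⟩ := hZc.csInf_mem hZne hZb
  set t := sInf Z with ht
  have hval' : (w * γ t).re = x := hval
  have hpt : p ≠ t := by
    intro h
    rw [h, hval', Set.mem_Ioo, min_lt_iff, lt_max_iff] at hx
    grind
  have hqt : t ≠ q := by
    intro h
    rw [← h, hval', Set.mem_Ioo, min_lt_iff, lt_max_iff] at hx
    grind
  have hpt' : p < t := lt_of_le_of_ne hp' hpt
  refine ⟨t, ⟨hpt', lt_of_le_of_ne hq' hqt⟩, hsub ⟨hp', hq'⟩, hval', Or.inr fun ε hε => ?_⟩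
  have hlt : max p (t - ε / 2) < t := max_lt hpt' (by linarith)
  have hmem : max p (t - ε / 2) ∈ Set.Icc p q := ⟨le_max_left _ _, hlt.le.trans hq'⟩
  exact ⟨_, hsub hmem, lt_of_lt_of_le (by linarith) (le_max_right _ _), hlt,
    fun h => absurd (csInf_le hZb ⟨hmem, h⟩) (not_le.2 hlt)⟩

lemma card_crossings_le_encard_entryPoints {γ : ℝ → ℂ} (hγ : ContinuousOn γ (Set.Icc 0 1)) (w : ℂ)
    {s : ℕ → ℝ} (hs : Monotone s) (hs' : ∀ i, s i ∈ Set.Icc (0 : ℝ) 1) (n : ℕ) (x : ℝ) :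
    ({i ∈ Finset.range n | x ∈ Set.Ioo (min (w * γ (s i)).re (w * γ (s (i + 1))).re)
      (max (w * γ (s i)).re (w * γ (s (i + 1))).re)}.card : ℕ∞) ≤
      (entryPoints γ (planeLine w x)).encard := by
  set F := {i ∈ Finset.range n | x ∈ Set.Ioo (min (w * γ (s i)).re (w * γ (s (i + 1))).re)
      (max (w * γ (s i)).re (w * γ (s (i + 1))).re)} with hF
  have h : ∀ i ∈ F, ∃ t ∈ Set.Ioo (s i) (s (i + 1)), t ∈ entryPoints γ (planeLine w x) :=
    fun i hi => exists_mem_entryPoints hγ w (hs i.le_succ) (hs' _) (hs' _) (Finset.mem_filter.1 hi).2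
  choose! τ hτ hτ' using h
  have hinj : Set.InjOn τ (F : Set ℕ) := by
    have key : ∀ i ∈ F, ∀ j ∈ F, i < j → τ i < τ j := fun i hi j hj hij =>
      (hτ i hi).2.trans_le ((hs (Nat.succ_le_of_lt hij)).trans (hτ j hj).1.le)
    intro i hi j hj hij
    rcases lt_trichotomy i j with h | h | h
    · exact absurd hij (key i hi j hj h).ne
    · exact h
    · exact absurd hij (key j hj i hi h).ne'
  rw [← Set.encard_coe_eq_coe_finsetCard, ← hinj.encard_image]
  exact Set.encard_le_encard (Set.image_subset_iff.2 fun i hi => hτ' i hi)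

/-- A function of the real coordinate `Re (w z)` has two-dimensional variation at most its
one-dimensional variation: a curve with `N` entry points per line crosses each level at most `N`
times. -/
lemma planeVariation_comp_re_le {σ : Set ℂ} (f : ℝ → ℂ) (w : ℂ) {a b : ℝ}
    (hab : ∀ z ∈ σ, (w * z).re ∈ Set.Icc a b) :
    planeVariation (fun z : σ => f (w * z).re) ≤ eVariationOn f (Set.Icc a b) := by
  refine iSup₂_le fun γ hγ => ?_
  by_cases htop : variationFactor γ = ⊤
  · simp [htop]
  obtain ⟨N, hN⟩ := ENat.ne_top_iff_exists.1 htop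
  rw [← hN, ENat.toENNReal_coe, ← div_eq_mul_inv]
  refine ENNReal.div_le_of_le_mul ?_
  rw [mul_comm]
  refine iSup_le ?_
  rintro ⟨n, u, hu, -⟩
  refine sum_edist_le_mul_eVariationOn f (u := fun i => (w * γ (u i)).re)
    (fun i => hab _ (u i).2.2) fun x => ?_
  by_cases hw : w = 0
  · simp [hw]
  have h1 := card_crossings_le_encard_entryPoints hγ.continuousOn w (s := fun i => (u i : ℝ))
    (fun i j hij => hu hij) (fun i => (u i).2.1) n x
  have h2 : (entryPoints γ (planeLine w x)).encard ≤ variationFactor γ :=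
    le_iSup₂_of_le w hw (le_iSup (fun c : ℝ => (entryPoints γ (planeLine w c)).encard) x)
  exact_mod_cast (h1.trans h2).trans hN.symm.le

section Calculus

open Polynomial Filter Topology

/-! ### The `BV` norm on a symmetric interval -/

lemma eVariationOn_add_le (f g : ℝ → ℝ) (s : Set ℝ) :
    eVariationOn (f + g) s ≤ eVariationOn f s + eVariationOn g s := by
  refine iSup_le fun p => ?_
  refine le_trans ?_ (add_le_add (eVariationOn.sum_le (n := p.1) p.2.2.1 p.2.2.2)
    (eVariationOn.sum_le (n := p.1) p.2.2.1 p.2.2.2))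
  rw [← Finset.sum_add_distrib]
  exact Finset.sum_le_sum fun i _ => edist_add_add_le _ _ _ _

lemma eVariationOn_neg (f : ℝ → ℝ) (s : Set ℝ) : eVariationOn (-f) s = eVariationOn f s := by
  unfold eVariationOn
  simp only [Pi.neg_apply, edist_neg_neg]

lemma eVariationOn_mul_le (f g : ℝ → ℝ) {s : Set ℝ} {a b : ℝ≥0∞} (hf : ∀ x ∈ s, ‖f x‖ₑ ≤ a)
    (hg : ∀ x ∈ s, ‖g x‖ₑ ≤ b) :
    eVariationOn (f * g) s ≤ a * eVariationOn g s + b * eVariationOn f s := by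
  refine iSup_le ?_
  rintro ⟨n, u, hu, hus⟩
  refine le_trans ?_ (add_le_add
    (mul_le_mul_right (eVariationOn.sum_le (f := g) (n := n) hu hus) a)
    (mul_le_mul_right (eVariationOn.sum_le (f := f) (n := n) hu hus) b))
  rw [Finset.mul_sum, Finset.mul_sum, ← Finset.sum_add_distrib]
  refine Finset.sum_le_sum fun i _ => ?_
  simp only [Pi.mul_apply, edist_eq_enorm_sub]
  have h : f (u (i + 1)) * g (u (i + 1)) - f (u i) * g (u i) =
      f (u (i + 1)) * (g (u (i + 1)) - g (u i)) + g (u i) * (f (u (i + 1)) - f (u i)) := by ring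
  rw [h]
  refine (enorm_add_le _ _).trans ?_
  rw [enorm_mul, enorm_mul]
  gcongr
  · exact hf _ (hus _)
  · exact hg _ (hus _)

lemma eVariationOn_le_of_monotoneOn_of_antitoneOn {f : ℝ → ℝ} {a b c : ℝ} (hab : a ≤ b) (hbc : b ≤ c)
    (h1 : MonotoneOn f (Set.Icc a b)) (h2 : AntitoneOn f (Set.Icc b c)) :
    eVariationOn f (Set.Icc a c) ≤
      ENNReal.ofReal (f b - f a) + ENNReal.ofReal (f b - f c) := by
  have e := eVariationOn.Icc_add_Icc f (s := Set.univ) hab hbc (Set.mem_univ b)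
  simp only [Set.univ_inter] at e
  rw [← e]
  gcongr
  · have := h1.eVariationOn_eq (Set.left_mem_Icc.2 hab) (Set.right_mem_Icc.2 hab)
    rw [Set.inter_self] at this
    exact this.le
  · have := MonotoneOn.eVariationOn_eq (f := -f) (s := Set.Icc b c) h2.neg
      (Set.left_mem_Icc.2 hbc) (Set.right_mem_Icc.2 hbc)
    rw [Set.inter_self, eVariationOn_neg] at this
    rw [this]
    apply le_of_eq
    congr 1
    simp only [Pi.neg_apply]
    ring

/-- The norm `|f 0| + var f` of `BV[-M, M]`, with value `∞` for functions of unbounded variation. It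
is equivalent to the usual one with `sup |f|` in place of `|f 0|`. -/
noncomputable def bvOn (M : ℝ) (f : ℝ → ℝ) : ℝ≥0∞ :=
  ‖f 0‖ₑ + eVariationOn f (Set.Icc (-M) M)

lemma bvOn_add_le (M : ℝ) (f g : ℝ → ℝ) : bvOn M (f + g) ≤ bvOn M f + bvOn M g := by
  unfold bvOn
  rw [add_add_add_comm]
  exact add_le_add (enorm_add_le _ _) (eVariationOn_add_le f g _)

lemma bvOn_neg (M : ℝ) (f : ℝ → ℝ) : bvOn M (-f) = bvOn M f := by
  unfold bvOn
  rw [eVariationOn_neg, Pi.neg_apply, enorm_neg]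

lemma bvOn_sub_comm (M : ℝ) (f g : ℝ → ℝ) : bvOn M (f - g) = bvOn M (g - f) := by
  rw [← bvOn_neg, neg_sub]

lemma bvOn_sub_le (M : ℝ) (f g h : ℝ → ℝ) : bvOn M (f - h) ≤ bvOn M (f - g) + bvOn M (g - h) := by
  rw [← sub_add_sub_cancel f g h]
  exact bvOn_add_le M _ _

lemma enorm_le_bvOn {M : ℝ} (f : ℝ → ℝ) {x : ℝ} (hx : x ∈ Set.Icc (-M) M) :
    ‖f x‖ₑ ≤ bvOn M f := by
  have h0 : (0 : ℝ) ∈ Set.Icc (-M) M := ⟨by linarith [hx.1, hx.2], by linarith [hx.1, hx.2]⟩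
  have h : ‖f x‖ₑ ≤ ‖f 0‖ₑ + ‖f x - f 0‖ₑ := by
    simpa using enorm_add_le (f 0) (f x - f 0)
  refine h.trans (add_le_add_right ?_ _)
  rw [← edist_eq_enorm_sub]
  exact eVariationOn.edist_le f hx h0

lemma bvOn_mul_le {M : ℝ} (hM : 0 ≤ M) (f g : ℝ → ℝ) :
    bvOn M (f * g) ≤ 2 * bvOn M f * bvOn M g := by
  have h0 : (0 : ℝ) ∈ Set.Icc (-M) M := ⟨by linarith, hM⟩
  have h1 : eVariationOn (f * g) (Set.Icc (-M) M) ≤ _ :=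
    eVariationOn_mul_le f g (fun x hx => enorm_le_bvOn f hx) (fun x hx => enorm_le_bvOn g hx)
  calc bvOn M (f * g)
      ≤ ‖f 0‖ₑ * ‖g 0‖ₑ + (bvOn M f * eVariationOn g (Set.Icc (-M) M) +
          bvOn M g * eVariationOn f (Set.Icc (-M) M)) := by
        unfold bvOn at h1 ⊢
        rw [Pi.mul_apply, enorm_mul]
        gcongr
    _ ≤ ‖f 0‖ₑ * bvOn M g + (bvOn M f * bvOn M g +
          bvOn M g * eVariationOn f (Set.Icc (-M) M)) := by
        gcongr
        · exact enorm_le_bvOn g h0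
        · exact le_add_self
    _ = bvOn M f * bvOn M g + bvOn M f * bvOn M g := by
        conv_rhs => rw [← add_comm]; enter [2]; rw [bvOn]
        ring
    _ = 2 * bvOn M f * bvOn M g := by ring

lemma eVariationOn_le_of_abs_deriv_le {f : ℝ → ℝ} (hf : Differentiable ℝ f) {M C : ℝ} (hC : 0 ≤ C)
    (h : ∀ x ∈ Set.Icc (-M) M, |deriv f x| ≤ C) :
    eVariationOn f (Set.Icc (-M) M) ≤ ENNReal.ofReal (2 * M * C) := by
  have hL : LipschitzOnWith C.toNNReal f (Set.Icc (-M) M) := by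
    refine (convex_Icc _ _).lipschitzOnWith_of_nnnorm_deriv_le (fun x _ => hf x) fun x hx => ?_
    rw [← NNReal.coe_le_coe, coe_nnnorm, Real.norm_eq_abs, Real.coe_toNNReal C hC]
    exact h x hx
  have := hL.comp_eVariationOn_le (g := id) (s := Set.Icc (-M) M) (fun x hx => hx)
  rw [eVariationOn_id_Icc] at this
  refine this.trans (le_of_eq ?_)
  rw [mul_comm, show ((C.toNNReal : ℝ≥0) : ℝ≥0∞) = ENNReal.ofReal C from rfl,
    ← ENNReal.ofReal_mul' hC]
  congr 1
  ring

lemma bvOn_ne_top {f : ℝ → ℝ} (hf : ContDiff ℝ 1 f) (M : ℝ) : bvOn M f ≠ ⊤ := by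
  obtain ⟨C, hC⟩ := (isCompact_Icc (a := -M) (b := M)).exists_bound_of_continuousOn
    (hf.continuous_deriv le_rfl).continuousOn
  have := eVariationOn_le_of_abs_deriv_le (hf.differentiable one_ne_zero) (abs_nonneg C)
    (fun x hx => (hC x hx).trans (le_abs_self C))
  exact ENNReal.add_ne_top.2 ⟨enorm_ne_top, ne_top_of_le_ne_top ENNReal.ofReal_ne_top this⟩

lemma Polynomial.contDiff_eval (p : ℝ[X]) : ContDiff ℝ 1 fun x => p.eval x := by
  simpa using p.contDiff_aeval (𝕜 := ℝ) (n := 1)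

lemma Polynomial.exists_derivative_eq (q : ℝ[X]) : ∃ p : ℝ[X], derivative p = q := by
  induction q using Polynomial.induction_on' with
  | add p q hp hq =>
    obtain ⟨p', rfl⟩ := hp
    obtain ⟨q', rfl⟩ := hq
    exact ⟨p' + q', derivative_add⟩
  | monomial n a =>
    refine ⟨monomial (n + 1) (a / (n + 1)), ?_⟩
    rw [derivative_monomial]
    congr 1
    push_cast
    field_simp

/-- Polynomials are dense in `C¹[-M, M]`, by the Weierstrass theorem for the derivative. -/
lemma exists_polynomial_deriv_near {f : ℝ → ℝ} (hf : ContDiff ℝ 1 f) (M : ℝ) {ε : ℝ}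
    (hε : 0 < ε) : ∃ p : ℝ[X],
      (∀ x ∈ Set.Icc (-M) M, |(derivative p).eval x - deriv f x| ≤ ε) ∧
      bvOn M ((fun x => p.eval x) - f) ≤ ENNReal.ofReal (2 * M * ε) := by
  obtain ⟨q, hq⟩ := exists_polynomial_near_of_continuousOn (-M) M (deriv f)
    (hf.continuous_deriv le_rfl).continuousOn ε hε
  obtain ⟨p, rfl⟩ := q.exists_derivative_eq
  refine ⟨p + C (f 0 - p.eval 0), fun x hx => ?_, ?_⟩
  · simpa using (hq x hx).le
  · have hd : Differentiable ℝ f := hf.differentiable one_ne_zero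
    have h := eVariationOn_le_of_abs_deriv_le (M := M)
      (f := (fun x => (p + C (f 0 - p.eval 0)).eval x) - f)
      ((p + C (f 0 - p.eval 0)).differentiable.sub hd) hε.le fun x hx => by
        rw [deriv_sub (p + C (f 0 - p.eval 0)).differentiableAt (hd x), Polynomial.deriv]
        simpa using (hq x hx).le
    unfold bvOn
    simpa using h

/-! ### The functional calculus -/

/-- The value `p(a)` of a real polynomial at an element of a complex algebra. Real coefficients
suffice for every function of a well-bounded operator that is used below. -/
noncomputable def realEval {E : Type*} [Ring E] [Algebra ℂ E] (a : E) : ℝ[X] →+* E :=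
  ((aeval a : ℂ[X] →ₐ[ℂ] E) : ℂ[X] →+* E).comp (mapRingHom Complex.ofRealHom)

section

variable {E : Type*} [Ring E] [Algebra ℂ E]

@[simp] lemma realEval_X (a : E) : realEval a X = a := by simp [realEval]

@[simp] lemma realEval_C (a : E) (r : ℝ) : realEval a (C r) = algebraMap ℂ E r := by
  simp [realEval]

lemma Commute.realEval {a b : E} (h : Commute b a) (p : ℝ[X]) : Commute b (realEval a p) := by
  induction p using Polynomial.induction_on' with
  | add p q hp hq => rw [map_add]; exact hp.add_right hq
  | monomial n r =>
    rw [← C_mul_X_pow_eq_monomial, map_mul, map_pow, realEval_X, realEval_C]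
    exact (show Commute b _ from (Algebra.commutes (r : ℂ) b).symm).mul_right (h.pow_right n)

end

/-- The polynomial calculus of `a` is bounded by `K` for the `BV` norm on `[-M, M]`. -/
def BVBound {E : Type*} [NormedRing E] [NormedAlgebra ℂ E] (a : E) (M : ℝ) (K : ℝ≥0) : Prop :=
  ∀ p : ℝ[X], ‖realEval a p‖ₑ ≤ K * bvOn M (fun x => p.eval x)

/-- `L` is the value `f(a)` obtained by extending the polynomial calculus of `a` to limits in the
`BV` norm of `[-M, M]`. -/
def IsCalc {E : Type*} [NormedRing E] [NormedAlgebra ℂ E] (a : E) (M : ℝ) (f : ℝ → ℝ) (L : E) :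
    Prop :=
  ∃ p : ℕ → ℝ[X], Tendsto (fun k => bvOn M ((fun x => (p k).eval x) - f)) atTop (𝓝 0) ∧
    Tendsto (fun k => realEval a (p k)) atTop (𝓝 L)

namespace IsCalc

variable {E : Type*} [NormedRing E] [NormedAlgebra ℂ E] {a : E} {M : ℝ} {K : ℝ≥0}

lemma polynomial (a : E) (M : ℝ) (p : ℝ[X]) : IsCalc a M (fun x => p.eval x) (realEval a p) :=
  ⟨fun _ => p, by simp [bvOn, eVariationOn], tendsto_const_nhds⟩

lemma sub {f g : ℝ → ℝ} {L L' : E} (hf : IsCalc a M f L) (hg : IsCalc a M g L') :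
    IsCalc a M (f - g) (L - L') := by
  obtain ⟨p, hp, hp'⟩ := hf
  obtain ⟨q, hq, hq'⟩ := hg
  refine ⟨fun k => p k - q k, ?_, by simpa only [map_sub] using hp'.sub hq'⟩
  refine tendsto_of_tendsto_of_tendsto_of_le_of_le tendsto_const_nhds
    (by simpa using hp.add hq) (fun _ => bot_le) fun k => ?_
  have e : (fun x => (p k - q k).eval x) - (f - g) =
      ((fun x => (p k).eval x) - f) + -((fun x => (q k).eval x) - g) := by
    ext x
    simp
    ring
  rw [e]
  refine (bvOn_add_le M _ _).trans ?_
  rw [bvOn_neg]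

lemma enorm_le {f : ℝ → ℝ} {L : E} (ha : BVBound a M K) (hf : IsCalc a M f L) :
    ‖L‖ₑ ≤ K * bvOn M f := by
  obtain ⟨p, hp, hp'⟩ := hf
  have h : Tendsto (fun k => (K : ℝ≥0∞) * (bvOn M ((fun x => (p k).eval x) - f) + bvOn M f)) atTop
      (𝓝 (K * (0 + bvOn M f))) :=
    ENNReal.Tendsto.const_mul (hp.add tendsto_const_nhds) (Or.inr ENNReal.coe_ne_top)
  rw [zero_add] at h
  refine le_of_tendsto_of_tendsto hp'.enorm h (Eventually.of_forall fun k => (ha _).trans ?_)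
  refine mul_le_mul_right ?_ _
  simpa using bvOn_add_le M ((fun x => (p k).eval x) - f) f

lemma unique {f : ℝ → ℝ} {L L' : E} (ha : BVBound a M K) (hf : IsCalc a M f L)
    (hf' : IsCalc a M f L') : L = L' := by
  have h := (hf.sub hf').enorm_le ha
  have h0 : bvOn M (f - f) = 0 := by simp [bvOn, eVariationOn]
  rw [h0, mul_zero, nonpos_iff_eq_zero, enorm_eq_zero, sub_eq_zero] at h
  exact h

lemma mul {f g : ℝ → ℝ} {L L' : E} (hM : 0 ≤ M) (hf : IsCalc a M f L) (hg : IsCalc a M g L')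
    (hf' : bvOn M f ≠ ⊤) (hg' : bvOn M g ≠ ⊤) : IsCalc a M (f * g) (L * L') := by
  obtain ⟨p, hp, hp'⟩ := hf
  obtain ⟨q, hq, hq'⟩ := hg
  refine ⟨fun k => p k * q k, ?_, by simpa only [map_mul] using hp'.mul hq'⟩
  have h1 : Tendsto (fun k => 2 * (bvOn M ((fun x => (p k).eval x) - f) + bvOn M f) *
      bvOn M ((fun x => (q k).eval x) - g) +
      2 * bvOn M g * bvOn M ((fun x => (p k).eval x) - f)) atTop (𝓝 0) := by
    have e1 : Tendsto (fun k => 2 * (bvOn M ((fun x => (p k).eval x) - f) + bvOn M f)) atTop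
        (𝓝 (2 * (0 + bvOn M f))) :=
      ENNReal.Tendsto.const_mul (hp.add tendsto_const_nhds) (Or.inr ENNReal.ofNat_ne_top)
    have e2 := ENNReal.Tendsto.mul e1
      (Or.inr ENNReal.zero_ne_top) hq (Or.inr (by finiteness))
    have e3 : Tendsto (fun k => 2 * bvOn M g * bvOn M ((fun x => (p k).eval x) - f)) atTop
        (𝓝 (2 * bvOn M g * 0)) :=
      ENNReal.Tendsto.const_mul hp (Or.inr (by finiteness))
    simpa using e2.add e3
  refine tendsto_of_tendsto_of_tendsto_of_le_of_le tendsto_const_nhds h1 (fun _ => bot_le)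
    fun k => ?_
  have e : (fun x => (p k * q k).eval x) - f * g =
      (fun x => (p k).eval x) * ((fun x => (q k).eval x) - g) +
        g * ((fun x => (p k).eval x) - f) := by
    ext x
    simp
    ring
  simp only [e]
  refine (bvOn_add_le M _ _).trans (add_le_add ((bvOn_mul_le hM _ _).trans ?_)
    (bvOn_mul_le hM _ _))
  refine mul_le_mul_left (mul_le_mul_right ?_ _) _
  simpa using bvOn_add_le M ((fun x => (p k).eval x) - f) f

lemma commute {f : ℝ → ℝ} {L b : E} (hf : IsCalc a M f L) (h : Commute b a) : Commute b L := by
  obtain ⟨p, -, hp⟩ := hf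
  have h1 : Tendsto (fun k => b * realEval a (p k)) atTop (𝓝 (L * b)) :=
    (hp.mul_const b).congr fun k => (h.realEval (p k)).eq.symm
  exact tendsto_nhds_unique (hp.const_mul b) h1

lemma exists_of_contDiff [CompleteSpace E] {f : ℝ → ℝ} (hM : 0 ≤ M) (ha : BVBound a M K)
    (hf : ContDiff ℝ 1 f) : ∃ L, IsCalc a M f L := by
  choose p _ hp using fun k : ℕ =>
    exists_polynomial_deriv_near hf M (ε := 1 / ((k : ℝ) + 1)) (by positivity)
  have hlim : Tendsto (fun k : ℕ => 2 * M * (1 / ((k : ℝ) + 1))) atTop (𝓝 0) := by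
    simpa using tendsto_one_div_add_atTop_nhds_zero_nat.const_mul (2 * M)
  have hp0 : Tendsto (fun k => bvOn M ((fun x => (p k).eval x) - f)) atTop (𝓝 0) := by
    refine tendsto_of_tendsto_of_tendsto_of_le_of_le tendsto_const_nhds ?_ (fun _ => bot_le) hp
    simpa using ENNReal.tendsto_ofReal hlim
  have hcauchy : CauchySeq fun k => realEval a (p k) := by
    refine cauchySeq_of_le_tendsto_0 (fun k : ℕ => K * (2 * (2 * M * (1 / ((k : ℝ) + 1)))))
      (fun n m N hn hm => ?_) (by simpa using (hlim.const_mul 2).const_mul (K : ℝ))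
    have hmono : ∀ n : ℕ, N ≤ n → bvOn M ((fun x => (p n).eval x) - f) ≤
        ENNReal.ofReal (2 * M * (1 / ((N : ℝ) + 1))) := fun n hn =>
      (hp n).trans (ENNReal.ofReal_le_ofReal (by gcongr))
    have h1 : ‖realEval a (p n) - realEval a (p m)‖ₑ ≤
        ENNReal.ofReal (K * (2 * (2 * M * (1 / ((N : ℝ) + 1))))) := by
      rw [← map_sub]
      refine (ha _).trans ?_
      rw [ENNReal.ofReal_mul K.coe_nonneg, ENNReal.ofReal_coe_nnreal]
      refine mul_le_mul_right ?_ _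
      have e : (fun x => (p n - p m).eval x) = (fun x => (p n).eval x) - (fun x => (p m).eval x) := by
        ext x
        simp
      rw [e, two_mul, ENNReal.ofReal_add (by positivity) (by positivity)]
      refine (bvOn_sub_le M _ f _).trans (add_le_add (hmono n hn) ?_)
      rw [bvOn_sub_comm]
      exact hmono m hm
    rw [dist_eq_norm, ← ENNReal.ofReal_le_ofReal_iff (by positivity), ofReal_norm]
    exact h1
  obtain ⟨L, hL⟩ := cauchySeq_tendsto_of_complete hcauchy
  exact ⟨L, p, hp0, hL⟩

end IsCalc

end Calculus

section TestFunctions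

open Polynomial Filter Topology

/-! ### Test functions and test polynomials -/

/-- A small monotone `C¹` truncation `c` of the identity function: `x - c x` vanishes near `0` and is
close to `x` in variation. -/
lemma exists_contDiff_eq_id_near_zero {ε : ℝ} (hε : 0 < ε) :
    ∃ c : ℝ → ℝ, ContDiff ℝ 1 c ∧ Monotone c ∧ (∀ x, |c x| ≤ 2 * ε) ∧ ∀ x, |x| ≤ ε → c x = x := by
  set ψ : ℝ → ℝ := fun t => max 0 (min 1 (2 - |t| / ε)) with hψ
  have hψc : Continuous ψ := by fun_prop
  have hψ0 : ∀ t, 0 ≤ ψ t := fun t => le_max_left _ _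
  have hψ1 : ∀ t, ψ t ≤ 1 := fun t => max_le zero_le_one (min_le_left _ _)
  have hψε : ∀ t, |t| ≤ ε → ψ t = 1 := fun t ht => by
    have : |t| / ε ≤ 1 := (div_le_one hε).2 ht
    simp only [hψ]
    rw [min_eq_left (by linarith), max_eq_right zero_le_one]
  have hψ2 : ∀ t, 2 * ε ≤ |t| → ψ t = 0 := fun t ht => by
    have : 2 ≤ |t| / ε := (le_div_iff₀ hε).2 ht
    simp only [hψ]
    rw [min_eq_right (by linarith), max_eq_left (by linarith)]
  have hder : ∀ x, HasDerivAt (fun x => ∫ t in (0 : ℝ)..x, ψ t) (ψ x) x := fun x =>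
    (hψc.integral_hasStrictDerivAt 0 x).hasDerivAt
  have hint : ∀ x y, IntervalIntegrable ψ MeasureTheory.volume x y := hψc.intervalIntegrable
  have hmono : Monotone fun x => ∫ t in (0 : ℝ)..x, ψ t :=
    monotone_of_deriv_nonneg (fun x => (hder x).differentiableAt)
      fun x => by rw [(hder x).deriv]; exact hψ0 x
  have hsmall : ∀ x, |x| ≤ 2 * ε → |∫ t in (0 : ℝ)..x, ψ t| ≤ 2 * ε := fun x hx => by
    have := intervalIntegral.norm_integral_le_of_norm_le_const (a := 0) (b := x) (f := ψ) (C := 1)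
      fun t _ => by rw [Real.norm_eq_abs, abs_of_nonneg (hψ0 t)]; exact hψ1 t
    rw [Real.norm_eq_abs, sub_zero, one_mul] at this
    exact this.trans hx
  have htail : ∀ x y, (∀ t ∈ Set.uIcc x y, 2 * ε ≤ |t|) → ∫ t in x..y, ψ t = 0 := fun x y h => by
    rw [intervalIntegral.integral_congr (g := fun _ => 0) fun t ht => hψ2 t (h t ht)]
    simp
  refine ⟨fun x => ∫ t in (0 : ℝ)..x, ψ t, ?_, hmono, fun x => ?_, fun x hx => ?_⟩
  · rw [contDiff_one_iff_deriv]
    refine ⟨fun x => (hder x).differentiableAt, ?_⟩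
    rwa [show deriv (fun x => ∫ t in (0 : ℝ)..x, ψ t) = ψ from funext fun x => (hder x).deriv]
  · rcases le_or_gt |x| (2 * ε) with h | h
    · exact hsmall x h
    rcases lt_abs.1 h with h | h
    · have e := intervalIntegral.integral_add_adjacent_intervals (hint 0 (2 * ε)) (hint (2 * ε) x)
      rw [htail (2 * ε) x fun t ht => ?_, add_zero] at e
      · simp only [← e]
        exact hsmall _ (by rw [abs_of_pos (by positivity)])
      · rw [Set.uIcc_of_le h.le] at ht
        exact ht.1.trans (le_abs_self t)
    · have e := intervalIntegral.integral_add_adjacent_intervals (hint 0 (-(2 * ε)))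
        (hint (-(2 * ε)) x)
      rw [htail (-(2 * ε)) x fun t ht => ?_, add_zero] at e
      · simp only [← e]
        exact hsmall _ (by rw [abs_neg, abs_of_pos (by positivity)])
      · rw [Set.uIcc_of_ge (by linarith)] at ht
        exact le_trans (by linarith [ht.2]) (neg_le_abs t)
  · beta_reduce
    rw [intervalIntegral.integral_congr (g := fun _ => 1) fun t ht => hψε t ?_]
    · simp
    · have h1 := Set.abs_sub_left_of_mem_uIcc ht
      simp only [sub_zero] at h1
      exact h1.trans hx

/-- Polynomials with slope about `1` at `s` and arbitrarily small variation. -/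
lemma exists_polynomial_slope {M s : ℝ} (hs : |s| ≤ M) {δ : ℝ} (hδ : 0 < δ) :
    ∃ p : ℝ[X], 1 / 2 ≤ |(derivative p).eval s| ∧
      bvOn M (fun x => p.eval x) ≤ ENNReal.ofReal δ := by
  have hM : 0 ≤ M := (abs_nonneg s).trans hs
  obtain ⟨c, hc, hmono, hb, hid⟩ := exists_contDiff_eq_id_near_zero (ε := δ / 12) (by positivity)
  set f : ℝ → ℝ := fun x => c (x - s) with hf
  have hfc : ContDiff ℝ 1 f := hc.comp (contDiff_id.sub contDiff_const)
  have hfd : deriv f s = 1 := by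
    have h : f =ᶠ[𝓝 s] fun x => x - s := by
      filter_upwards [Metric.ball_mem_nhds s (show 0 < δ / 12 by positivity)] with x hx
      rw [Metric.mem_ball, Real.dist_eq] at hx
      exact hid _ hx.le
    rw [h.deriv_eq]
    simp
  have hfb : bvOn M f ≤ ENNReal.ofReal (δ / 2) := by
    have h1 : ‖f 0‖ₑ ≤ ENNReal.ofReal (δ / 6) := by
      rw [← ofReal_norm, Real.norm_eq_abs]
      exact ENNReal.ofReal_le_ofReal ((hb _).trans (by linarith))
    have h2 : eVariationOn f (Set.Icc (-M) M) ≤ ENNReal.ofReal (δ / 3) := by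
      have hfm : MonotoneOn f (Set.Icc (-M) M) := fun x _ y _ hxy =>
        hmono (sub_le_sub_right hxy s)
      have := hfm.eVariationOn_eq (Set.left_mem_Icc.2 (by linarith))
        (Set.right_mem_Icc.2 (by linarith))
      rw [Set.inter_self] at this
      rw [this]
      apply ENNReal.ofReal_le_ofReal
      have h3 := abs_le.1 (hb (M - s))
      have h4 := abs_le.1 (hb (-M - s))
      simp only [hf]
      linarith [h3.2, h4.1]
    refine (add_le_add h1 h2).trans (le_of_eq ?_)
    rw [← ENNReal.ofReal_add (by positivity) (by positivity)]
    congr 1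
    ring
  have hη : 0 < min (1 / 2) (δ / (4 * (M + 1))) := by positivity
  obtain ⟨p, hp, hp'⟩ := exists_polynomial_deriv_near hfc M hη
  refine ⟨p, ?_, ?_⟩
  · have h := (hp s (abs_le.1 hs)).trans (min_le_left _ _)
    rw [hfd] at h
    have := abs_le.1 h
    exact le_trans (by linarith) (le_abs_self _)
  · have h := bvOn_add_le M ((fun x => p.eval x) - f) f
    rw [sub_add_cancel] at h
    refine h.trans ((add_le_add hp' hfb).trans ?_)
    rw [← ENNReal.ofReal_add (by positivity) (by positivity)]
    apply ENNReal.ofReal_le_ofReal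
    have h1 : 2 * M * min (1 / 2) (δ / (4 * (M + 1))) ≤ 2 * M * (δ / (4 * (M + 1))) := by
      gcongr
      exact min_le_right _ _
    have h2 : 2 * M * (δ / (4 * (M + 1))) ≤ δ / 2 := by
      rw [mul_div_assoc', div_le_div_iff₀ (by positivity) (by positivity)]
      nlinarith
    linarith

/-- The polynomial `(1 - ((x - c) / L)²) ^ n`. -/
noncomputable def peak (c L : ℝ) (n : ℕ) : ℝ[X] := (1 - ((X - C c) * C (1 / L)) ^ 2) ^ n

/-- The peak polynomials have uniformly bounded variation on a real interval, although they grow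
exponentially at the points above and below `c`. -/
lemma bvOn_peak_le {M c L : ℝ} (hc : |c| ≤ M) (hL : M + |c| ≤ L) (hL0 : 0 < L) (n : ℕ) :
    bvOn M (fun x => (peak c L n).eval x) ≤ 3 := by
  have hcM := abs_le.1 hc
  have e : (fun x => (peak c L n).eval x) = fun x => (1 - ((x - c) / L) ^ 2) ^ n := by
    ext x
    simp [peak, div_eq_mul_inv]
  have hin : ∀ x ∈ Set.Icc (-M) M, |(x - c) / L| ≤ 1 := fun x hx => by
    rw [abs_div, abs_of_pos hL0, div_le_one hL0]
    exact (abs_sub x c).trans (le_trans (by gcongr; exact abs_le.2 hx) hL)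
  have h0 : ∀ x ∈ Set.Icc (-M) M, 0 ≤ 1 - ((x - c) / L) ^ 2 := fun x hx => by
    have := (sq_le_one_iff_abs_le_one _).2 (hin x hx)
    linarith
  have hg0 : ∀ x ∈ Set.Icc (-M) M, 0 ≤ (1 - ((x - c) / L) ^ 2) ^ n :=
    fun x hx => pow_nonneg (h0 x hx) n
  have hg1 : ∀ x ∈ Set.Icc (-M) M, (1 - ((x - c) / L) ^ 2) ^ n ≤ 1 := fun x hx =>
    pow_le_one₀ (h0 x hx) (by linarith [sq_nonneg ((x - c) / L)])
  rw [e]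
  have hvar := eVariationOn_le_of_monotoneOn_of_antitoneOn (f := fun x => (1 - ((x - c) / L) ^ 2) ^ n)
    hcM.1 hcM.2
    (fun x hx y hy hxy => by
      have h := h0 x ⟨hx.1, hx.2.trans hcM.2⟩
      refine pow_le_pow_left₀ h (sub_le_sub_left ?_ 1) n
      rw [div_pow, div_pow]
      gcongr ?_ / _
      nlinarith [hy.2])
    (fun x hx y hy hxy => by
      have h := h0 y ⟨hcM.1.trans hy.1, hy.2⟩
      refine pow_le_pow_left₀ h (sub_le_sub_left ?_ 1) n
      rw [div_pow, div_pow]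
      gcongr ?_ / _
      nlinarith [hx.1])
  have hM : 0 ≤ M := (abs_nonneg c).trans hc
  have hle : ∀ x ∈ Set.Icc (-M) M, ENNReal.ofReal ((1 - ((c - c) / L) ^ 2) ^ n -
      (1 - ((x - c) / L) ^ 2) ^ n) ≤ 1 := fun x hx => by
    rw [ENNReal.ofReal_le_one]
    linarith [hg0 x hx, hg1 c hcM]
  have hz : ‖(1 - ((0 - c) / L) ^ 2) ^ n‖ₑ ≤ 1 := by
    have hmem : (0 : ℝ) ∈ Set.Icc (-M) M := ⟨by linarith, hM⟩
    rw [← ofReal_norm, Real.norm_eq_abs, abs_of_nonneg (hg0 0 hmem), ENNReal.ofReal_le_one]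
    exact hg1 0 hmem
  refine (add_le_add hz (hvar.trans (add_le_add (hle _ (Set.left_mem_Icc.2 (by linarith)))
    (hle _ (Set.right_mem_Icc.2 (by linarith)))))).trans (le_of_eq ?_)
  norm_num

end TestFunctions

section WellBounded

open Polynomial Filter Topology

/-! ### Eigenvectors of well-bounded operators -/

variable {X : Type*} [NormedAddCommGroup X] [NormedSpace ℂ X] {A B T : X →L[ℂ] X}

/-- The interval of a well-bounded operator may be enlarged, so that finitely many well-bounded
operators can be treated on the same interval `[-M, M]`. -/
lemma IsWellBounded.exists_bvBound (hA : IsWellBounded A) :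
    ∃ M₀ : ℝ, 0 < M₀ ∧ ∃ K : ℝ≥0, ∀ M, M₀ ≤ M → BVBound A M K := by
  obtain ⟨a, b, K, hab, h⟩ := hA
  refine ⟨max (max |a| |b|) 1, by positivity, 2 * K, fun M hM p => ?_⟩
  have haM : |a| ≤ M := (le_max_left _ _).trans ((le_max_left _ _).trans hM)
  have hbM : |b| ≤ M := (le_max_right _ _).trans ((le_max_left _ _).trans hM)
  have hev : ∀ t : ℝ, (p.map Complex.ofRealHom).eval (t : ℂ) = (p.eval t : ℝ) := fun t => by
    rw [eval_map]
    exact eval₂_at_apply Complex.ofRealHom t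
  have h1 := h (p.map Complex.ofRealHom)
  simp only [hev] at h1
  have h2 : eVariationOn (fun t : ℝ => ((p.eval t : ℝ) : ℂ)) (Set.Icc a b) ≤
      bvOn M (fun x => p.eval x) := by
    have h3 := (Complex.isometry_ofReal.lipschitz.lipschitzOnWith
      (s := Set.univ)).comp_eVariationOn_le
      (g := fun x => p.eval x) (s := Set.Icc a b) (Set.mapsTo_univ _ _)
    rw [ENNReal.coe_one, one_mul] at h3
    exact h3.trans ((eVariationOn.mono _ (Set.Icc_subset_Icc (abs_le.1 haM).1
      (abs_le.1 hbM).2)).trans le_add_self)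
  have h3 : ‖((p.eval b : ℝ) : ℂ)‖ₑ ≤ bvOn M (fun x => p.eval x) := by
    have : ‖((p.eval b : ℝ) : ℂ)‖ₑ = ‖p.eval b‖ₑ := by
      rw [← ofReal_norm, ← ofReal_norm, Complex.norm_real]
    rw [this]
    exact enorm_le_bvOn (fun x => p.eval x) (abs_le.1 hbM)
  refine h1.trans ((mul_le_mul_right (add_le_add h3 h2) _).trans (le_of_eq ?_))
  push_cast
  ring

lemma BVBound.norm_le {M : ℝ} {K : ℝ≥0} (hA : BVBound A M K) (p : ℝ[X]) {C : ℝ}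
    (hC : 0 ≤ C) (hp : bvOn M (fun x => p.eval x) ≤ ENNReal.ofReal C) :
    ‖realEval A p‖ ≤ K * C := by
  have h := (hA p).trans (mul_le_mul_right hp _)
  rwa [← ENNReal.ofReal_coe_nnreal, ← ENNReal.ofReal_mul K.coe_nonneg, ← ofReal_norm,
    ENNReal.ofReal_le_ofReal_iff (by positivity)] at h

lemma realEval_apply_of_eigenvector {x : X} {μ : ℂ} (hx : A x = μ • x) (p : ℝ[X]) :
    realEval A p x = (p.map Complex.ofRealHom).eval μ • x := by
  induction p using Polynomial.induction_on with
  | C r => simp [Algebra.algebraMap_eq_smul_one]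
  | add p q hp hq => simp [hp, hq, add_smul]
  | monomial n r h =>
    rw [pow_succ, ← mul_assoc]
    generalize C r * Polynomial.X ^ n = q at h
    rw [map_mul, realEval_X, mul_apply_eq_comp, hx, map_smul, h,
      smul_smul, Polynomial.map_mul, eval_mul, map_X, eval_X, mul_comm]

/-- The value of a polynomial on a Jordan block of size two. -/
lemma realEval_apply_of_jordan {x y : X} {s : ℝ} (hx : A x = (s : ℂ) • x + y)
    (hy : A y = (s : ℂ) • y) (p : ℝ[X]) :
    realEval A p x = ((p.eval s : ℝ) : ℂ) • x + (((derivative p).eval s : ℝ) : ℂ) • y := by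
  have hy' : ∀ p : ℝ[X], realEval A p y = ((p.eval s : ℝ) : ℂ) • y := fun p => by
    rw [realEval_apply_of_eigenvector hy, eval_map]
    congr 1
    exact eval₂_at_apply Complex.ofRealHom s
  induction p using Polynomial.induction_on with
  | C r => simp [Algebra.algebraMap_eq_smul_one]
  | add p q hp hq =>
    simp only [map_add, add_apply, hp, hq, eval_add, Complex.ofReal_add]
    module
  | monomial n r h =>
    rw [pow_succ, ← mul_assoc]
    generalize C r * Polynomial.X ^ n = q at h
    rw [map_mul, realEval_X, mul_apply_eq_comp, hx, map_add,
      map_smul, h, hy', derivative_mul, eval_add, eval_mul, eval_mul, derivative_X, mul_one, eval_X]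
    push_cast
    module

/-- The eigenvalues of a well-bounded operator are real. -/
lemma IsWellBounded.im_eq_zero_of_eigenvector (hA : IsWellBounded A) {x : X} (hx0 : x ≠ 0) {μ : ℂ}
    (hx : A x = μ • x) : μ.im = 0 := by
  obtain ⟨M₀, hM₀, K, hK⟩ := hA.exists_bvBound
  set M := max M₀ |μ.re| with hM
  have hMpos : 0 < M := hM₀.trans_le (le_max_left _ _)
  set L := M + |μ.re| with hL
  have hLpos : 0 < L := by positivity
  by_contra him
  have hone : 1 < 1 + (μ.im / L) ^ 2 := by
    have : 0 < (μ.im / L) ^ 2 := by positivity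
    linarith
  obtain ⟨n, hn⟩ :=
    ((tendsto_pow_atTop_atTop_of_one_lt hone).eventually_gt_atTop (K * 3 : ℝ)).exists
  have h1 := (hK M (le_max_left _ _)).norm_le (peak μ.re L n) (C := 3) (by norm_num)
    (by simpa using bvOn_peak_le (le_max_right M₀ |μ.re|) (le_refl L) hLpos n)
  have h2 := (realEval A (peak μ.re L n)).le_opNorm x
  have e : ((peak μ.re L n).map Complex.ofRealHom).eval μ =
      (((1 + (μ.im / L) ^ 2) ^ n : ℝ) : ℂ) := by
    have h3 : μ - μ.re = μ.im * Complex.I := by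
      apply Complex.ext <;> simp
    simp only [peak, Polynomial.map_pow, Polynomial.map_sub, Polynomial.map_mul, Polynomial.map_one,
      map_X, map_C, eval_pow, eval_sub, eval_mul, eval_one, eval_X, eval_C, Complex.ofRealHom_eq_coe,
      h3]
    push_cast
    congr 1
    linear_combination (-(μ.im / L : ℂ) ^ 2) * Complex.I_sq
  rw [realEval_apply_of_eigenvector hx, e, norm_smul, Complex.norm_real, Real.norm_eq_abs,
    abs_of_nonneg (by positivity)] at h2
  have h3 := le_of_mul_le_mul_right h2 (norm_pos_iff.2 hx0)
  linarith

/-- A well-bounded operator has no Jordan blocks. -/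
lemma IsWellBounded.apply_eq_smul_of_jordan (hA : IsWellBounded A) {x : X} {μ : ℂ}
    (hx : A (A x - μ • x) = μ • (A x - μ • x)) : A x = μ • x := by
  by_contra hne
  rw [← sub_eq_zero] at hne
  have him := hA.im_eq_zero_of_eigenvector hne hx
  obtain ⟨s, rfl⟩ : ∃ s : ℝ, (s : ℂ) = μ := ⟨μ.re, Complex.ext rfl (by simp [him])⟩
  obtain ⟨M₀, hM₀, K, hK⟩ := hA.exists_bvBound
  set M := max M₀ |s| with hM
  set y := A x - (s : ℂ) • x with hy
  have hpos : 0 < ‖y‖ := norm_pos_iff.2 hne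
  -- `δ` is so small that `(K + 1) δ ‖x‖ < ‖y‖ / 2`.
  set δ := ‖y‖ / (4 * (K + 1) * (‖x‖ + 1)) with hδ
  have hδpos : 0 < δ := by positivity
  obtain ⟨p, hp, hp'⟩ := exists_polynomial_slope (le_max_right M₀ |s|) hδpos
  have h1 := (hK M (le_max_left _ _)).norm_le p hδpos.le hp'
  have h2 : |p.eval s| ≤ δ := by
    have := (enorm_le_bvOn (fun x => p.eval x) (abs_le.1 (le_max_right M₀ |s|))).trans hp'
    rwa [← ofReal_norm, ENNReal.ofReal_le_ofReal_iff hδpos.le] at this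
  have h3 := realEval_apply_of_jordan (A := A) (x := x) (y := y) (s := s) (by rw [hy]; abel) hx p
  have h4 : (((derivative p).eval s : ℝ) : ℂ) • y =
      realEval A p x - ((p.eval s : ℝ) : ℂ) • x := by rw [h3]; abel
  have h5 : 1 / 2 * ‖y‖ ≤ K * δ * ‖x‖ + δ * ‖x‖ := by
    calc 1 / 2 * ‖y‖ ≤ |(derivative p).eval s| * ‖y‖ := by gcongr
      _ = ‖realEval A p x - ((p.eval s : ℝ) : ℂ) • x‖ := by
        rw [← h4, norm_smul, Complex.norm_real, Real.norm_eq_abs]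
      _ ≤ ‖realEval A p x‖ + ‖((p.eval s : ℝ) : ℂ) • x‖ := norm_sub_le _ _
      _ ≤ K * δ * ‖x‖ + δ * ‖x‖ := by
        gcongr
        · exact (ContinuousLinearMap.le_opNorm _ _).trans (by gcongr)
        · rw [norm_smul, Complex.norm_real, Real.norm_eq_abs]
          gcongr
  have h6 : δ * (4 * (K + 1) * (‖x‖ + 1)) = ‖y‖ := by
    rw [hδ]
    field_simp
  nlinarith [norm_nonneg x, K.coe_nonneg, mul_nonneg hδpos.le K.coe_nonneg]

/-- A well-bounded operator is diagonalisable, with real eigenvalues, on every finite-dimensional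
invariant subspace. -/
lemma IsWellBounded.le_iSup_eigenspace (hA : IsWellBounded A) (V : Submodule ℂ X)
    [FiniteDimensional ℂ V] (hV : ∀ x ∈ V, A x ∈ V) :
    V ≤ ⨆ s : ℝ, V ⊓ Module.End.eigenspace (A : X →ₗ[ℂ] X) (s : ℂ) := by
  set f : Module.End ℂ V := (A : X →ₗ[ℂ] X).restrict hV with hf
  have htop := congrArg (Submodule.map V.subtype) (Module.End.iSup_maxGenEigenspace_eq_top f)
  rw [Submodule.map_iSup, Submodule.map_top, Submodule.range_subtype] at htop
  refine htop.symm.le.trans (iSup_le fun μ => ?_)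
  rintro _ ⟨v, hv, rfl⟩
  rw [SetLike.mem_coe, Module.End.mem_maxGenEigenspace] at hv
  obtain ⟨k, hk⟩ := hv
  have key : ∀ k : ℕ, ∀ v : V, ((f - μ • 1) ^ k) v = 0 → A (v : X) = μ • (v : X) := by
    intro k
    induction k with
    | zero =>
      intro v hv
      have : v = 0 := by simpa using hv
      simp [this]
    | succ k ih =>
      intro v hv
      rw [pow_succ, Module.End.mul_apply] at hv
      exact hA.apply_eq_smul_of_jordan (by simpa [hf] using ih _ hv)
  have hAv := key k v hk
  by_cases hv0 : (v : X) = 0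
  · simp [hv0]
  have him := hA.im_eq_zero_of_eigenvector hv0 hAv
  refine Submodule.mem_iSup_of_mem μ.re ⟨v.2, ?_⟩
  rw [SetLike.mem_coe, Module.End.mem_eigenspace_iff,
    show ((μ.re : ℝ) : ℂ) = μ from Complex.ext rfl (by simp [him])]
  exact hAv

end WellBounded

section Cutoff

open Polynomial Filter Topology

/-! ### Spectral cut-offs of the real part of a compact operator -/

variable {X : Type*} [NormedAddCommGroup X] [NormedSpace ℂ X] {A B T : X →L[ℂ] X}

lemma IsCompactOperator.finiteDimensional_of_apply_eq_self {H : X →L[ℂ] X}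
    (hH : IsCompactOperator H) (V : Submodule ℂ X) (hV : ∀ x, x ∈ V ↔ H x = x) :
    FiniteDimensional ℂ V := by
  have hV' : ∀ x ∈ V, (H : X →ₗ[ℂ] X) x ∈ V := fun x hx => by
    rw [ContinuousLinearMap.coe_coe, (hV x).1 hx]
    exact hx
  have hclosed : IsClosed (V : Set X) := by
    have : (V : Set X) = {x | H x = x} := Set.ext hV
    rw [this]
    exact isClosed_eq H.continuous continuous_id
  have h := IsCompactOperator.restrict (f := (H : X →ₗ[ℂ] X)) hH hV' hclosed
  have e : ⇑((H : X →ₗ[ℂ] X).restrict hV') = (id : V → V) := by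
    ext x
    exact (hV x).1 x.2
  rw [e] at h
  exact FiniteDimensional.of_isCompactOperator_id h

lemma IsCompactOperator.pow_sub_pow {S U : X →L[ℂ] X} (h : IsCompactOperator (S - U)) (k : ℕ) :
    IsCompactOperator (S ^ k - U ^ k) := by
  induction k with
  | zero => simpa using isCompactOperator_zero
  | succ k ih =>
    have e : S ^ (k + 1) - U ^ (k + 1) = S * (S ^ k - U ^ k) + (S - U) * U ^ k := by
      rw [pow_succ', pow_succ' U]
      noncomm_ring
    rw [e]
    exact (ih.clm_comp S).add (h.comp_clm (U ^ k))

/-- If `h` vanishes near `0`, then `h / (1 + (x / M)²) ^ k` tends to `0` in variation: on the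
support of `h` the denominator grows exponentially. -/
lemma exists_tendsto_bvOn_div_pow {h : ℝ → ℝ} (hh : ContDiff ℝ 1 h) (hh1 : ∀ x, |h x| ≤ 1) {η : ℝ}
    (hη : 0 < η) (hh0 : ∀ x, |x| ≤ η → h x = 0) {M : ℝ} (hM : 0 < M) :
    ∃ c : ℕ → ℝ, Tendsto c atTop (𝓝 0) ∧ (∀ k, 0 ≤ c k) ∧
      ∀ k, bvOn M (fun x => h x * ((1 + (x * (1 / M)) ^ 2)⁻¹) ^ (k + 1)) ≤ ENNReal.ofReal (c k) := by
  set u : ℝ → ℝ := fun x => (1 + (x * (1 / M)) ^ 2)⁻¹ with hu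
  have hpos : ∀ x : ℝ, 0 < 1 + (x * (1 / M)) ^ 2 := fun x => by positivity
  have huc : ContDiff ℝ 1 u := ContDiff.inv (by fun_prop) fun x => (hpos x).ne'
  obtain ⟨C₁, hC₁⟩ := (isCompact_Icc (a := -M) (b := M)).exists_bound_of_continuousOn
    (hh.continuous_deriv le_rfl).continuousOn
  obtain ⟨C₂, hC₂⟩ := (isCompact_Icc (a := -M) (b := M)).exists_bound_of_continuousOn
    (huc.continuous_deriv le_rfl).continuousOn
  set ρ : ℝ := (1 + (η * (1 / M)) ^ 2)⁻¹ with hρ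
  have hρ0 : 0 < ρ := by positivity
  have hρ1 : ρ < 1 := by
    apply inv_lt_one_of_one_lt₀
    have : 0 < (η * (1 / M)) ^ 2 := by positivity
    linarith
  have hu0 : ∀ x, 0 ≤ u x := fun x => (inv_pos.2 (hpos x)).le
  have huρ : ∀ x, η ≤ |x| → u x ≤ ρ := fun x hx => by
    simp only [hu, hρ]
    apply inv_anti₀ (hpos η)
    rw [mul_pow, mul_pow, ← sq_abs x]
    gcongr
  set b : ℕ → ℝ := fun k => |C₁| * ρ ^ (k + 1) + (k + 1) * ρ ^ k * |C₂| with hb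
  have hb0 : ∀ k, 0 ≤ b k := fun k => by positivity
  have hblim : Tendsto b atTop (𝓝 0) := by
    have h1 := tendsto_pow_atTop_nhds_zero_of_lt_one hρ0.le hρ1
    have h2 := tendsto_self_mul_const_pow_of_lt_one hρ0.le hρ1
    have h3 := ((h1.comp (tendsto_add_atTop_nat 1)).const_mul |C₁|).add ((h2.add h1).mul_const |C₂|)
    simp only [mul_zero, add_zero, zero_mul] at h3
    refine h3.congr fun k => ?_
    simp only [hb, Function.comp_apply]
    ring
  refine ⟨fun k => 2 * M * b k, by simpa using hblim.const_mul (2 * M), fun k => by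
    have := hb0 k; positivity, fun k => ?_⟩
  have hd : ∀ x, HasDerivAt (fun x => h x * u x ^ (k + 1))
      (deriv h x * u x ^ (k + 1) + h x * (((k + 1 : ℕ) : ℝ) * u x ^ k * deriv u x)) x := fun x => by
    have h1 := ((hh.differentiable one_ne_zero) x).hasDerivAt
    have h2 := ((huc.differentiable one_ne_zero) x).hasDerivAt
    convert! h1.mul (h2.pow (k + 1)) using 1
  have hvar := eVariationOn_le_of_abs_deriv_le (f := fun x => h x * u x ^ (k + 1))
    (fun x => (hd x).differentiableAt) (M := M) (hb0 k) fun x hx => by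
      rw [(hd x).deriv]
      rcases le_or_gt η |x| with hx' | hx'
      · refine (abs_add_le _ _).trans (add_le_add ?_ ?_)
        · rw [abs_mul, abs_of_nonneg (pow_nonneg (hu0 x) _)]
          exact mul_le_mul ((hC₁ x hx).trans (le_abs_self C₁))
            (pow_le_pow_left₀ (hu0 x) (huρ x hx') _) (pow_nonneg (hu0 x) _) (abs_nonneg _)
        · rw [abs_mul, abs_mul, abs_mul, abs_of_nonneg (pow_nonneg (hu0 x) _), Nat.abs_cast]
          push_cast
          have hC := (hC₂ x hx).trans (le_abs_self C₂)
          rw [Real.norm_eq_abs] at hC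
          calc |h x| * ((k + 1) * u x ^ k * |deriv u x|)
              ≤ 1 * ((k + 1) * ρ ^ k * |C₂|) := by
                have := hu0 x
                gcongr
                · exact hh1 x
                · exact huρ x hx'
            _ = (k + 1) * ρ ^ k * |C₂| := one_mul _
      · have hd0 : deriv h x = 0 := by
          have he : h =ᶠ[𝓝 x] fun _ => 0 :=
            (continuous_abs.continuousAt.eventually_lt continuousAt_const hx').mono
              fun y hy => hh0 y (le_of_lt hy)
          rw [he.deriv_eq, deriv_const]
        rw [hd0, hh0 x hx'.le]
        simpa using hb0 k
  have h0 : h 0 = 0 := hh0 0 (by simpa using hη.le)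
  unfold bvOn
  simp only [h0, zero_mul, enorm_zero, zero_add]
  exact hvar


/-- Modulo compact operators `A² = -B²`, so that `(1 + (A / M)²) ^ k` is power bounded modulo
compact operators, while `h / (1 + (x / M)²) ^ k` tends to `0` in variation. Hence `h(A)` is a
limit of compact operators. -/
lemma IsSplitting.isCompactOperator_of_isCalc [CompleteSpace X] (hT : IsCompactOperator T)
    (hAB : IsSplitting T A B) {M : ℝ} (hM : 0 < M) {K K' : ℝ≥0} (hK : BVBound A M K)
    (hK' : BVBound B M K') {h : ℝ → ℝ} (hh : ContDiff ℝ 1 h) (hh1 : ∀ x, |h x| ≤ 1) {η : ℝ}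
    (hη : 0 < η) (hh0 : ∀ x, |x| ≤ η → h x = 0) {H : X →L[ℂ] X} (hH : IsCalc A M h H) :
    IsCompactOperator H := by
  obtain ⟨c, hc, hc0, hcb⟩ := exists_tendsto_bvOn_div_pow hh hh1 hη hh0 hM
  set P : ℝ[X] := 1 + (Polynomial.X * C (1 / M)) ^ 2 with hP
  set S := realEval A P with hS
  set U := realEval B (peak 0 M 1) with hU
  have hUk : ∀ k, ‖U ^ k‖ ≤ K' * 3 := fun k => by
    have e : peak 0 M k = peak 0 M 1 ^ k := by simp [peak]
    rw [hU, ← map_pow, ← e]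
    refine hK'.norm_le _ (by norm_num) ?_
    simpa using bvOn_peak_le (M := M) (c := 0) (L := M) (by simpa using hM.le) (by simp) hM k
  have hSU : IsCompactOperator (S - U) := by
    have e : S - U = T * ((((1 / M : ℝ) : ℂ) ^ 2) • (A - Complex.I • B)) := by
      have hc := hAB.commute.eq
      simp only [hS, hU, hP, peak, map_add, map_one, map_pow, map_mul, map_sub, realEval_X,
        realEval_C, Algebra.algebraMap_eq_smul_one, pow_one, mul_smul_comm, mul_one,
        Complex.ofReal_zero, zero_smul, sub_zero, hAB.eq_add]
      rw [_root_.smul_pow, _root_.smul_pow, add_mul, mul_sub, mul_sub, mul_smul_comm, smul_mul_assoc,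
        smul_mul_assoc, mul_smul_comm, smul_smul, Complex.I_mul_I, hc, pow_two A, pow_two B]
      module
    rw [e]
    exact hT.comp_clm _
  have hPpos : ∀ x : ℝ, 0 < 1 + (x * (1 / M)) ^ 2 := fun x => by positivity
  -- `R k = r k (A)` satisfies `H = R k * S ^ (k + 1)`, hence differs from
  -- `R k * (S ^ (k + 1) - U ^ (k + 1))` by the null sequence `R k * U ^ (k + 1)`.
  set r : ℕ → ℝ → ℝ := fun k x => h x * ((1 + (x * (1 / M)) ^ 2)⁻¹) ^ (k + 1) with hr
  have hrc : ∀ k, ContDiff ℝ 1 (r k) := fun k =>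
    hh.mul ((ContDiff.inv (by fun_prop) fun x => (hPpos x).ne').pow (k + 1))
  choose R hR using fun k => IsCalc.exists_of_contDiff hM.le hK (hrc k)
  have hRn : ∀ k, ‖R k‖ ≤ K * c k := fun k => by
    have := ((hR k).enorm_le hK).trans (mul_le_mul_right (hcb k) _)
    rwa [← ENNReal.ofReal_coe_nnreal, ← ENNReal.ofReal_mul K.coe_nonneg, ← ofReal_norm,
      ENNReal.ofReal_le_ofReal_iff (mul_nonneg K.coe_nonneg (hc0 k))] at this
  have hRS : ∀ k, R k * S ^ (k + 1) = H := fun k => by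
    have h1 := (hR k).mul hM.le (IsCalc.polynomial A M (P ^ (k + 1))) (bvOn_ne_top (hrc k) M)
      (bvOn_ne_top (P ^ (k + 1)).contDiff_eval M)
    have e : (r k * fun x => (P ^ (k + 1)).eval x) = h := by
      ext x
      have := (hPpos x).ne'
      simp only [hr, hP, Pi.mul_apply, eval_pow, eval_add, eval_mul, eval_one, eval_X, eval_C]
      rw [mul_assoc, ← mul_pow, inv_mul_cancel₀ this, one_pow, mul_one]
    rw [e, map_pow] at h1
    exact h1.unique hK hH
  have hlim : Tendsto (fun k => R k * U ^ (k + 1)) atTop (𝓝 0) := by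
    refine squeeze_zero_norm (a := fun k => K * c k * (K' * 3)) (fun k => ?_)
      (by simpa using (hc.const_mul (K : ℝ)).mul_const (K' * 3 : ℝ))
    have := hc0 k
    exact (norm_mul_le _ _).trans (mul_le_mul (hRn k) (hUk _) (norm_nonneg _) (by positivity))
  have hlim' : Tendsto (fun k => R k * (S ^ (k + 1) - U ^ (k + 1))) atTop (𝓝 H) := by
    have := hlim.const_sub H
    rw [sub_zero] at this
    refine this.congr fun k => ?_
    rw [mul_sub, hRS]
  exact isCompactOperator_of_tendsto hlim'
    (Eventually.of_forall fun k => (hSU.pow_sub_pow (k + 1)).clm_comp (R k))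

lemma exists_contDiff_cutoff {ε : ℝ} (hε : 0 < ε) :
    ∃ h : ℝ → ℝ, ContDiff ℝ 1 h ∧ (∀ x, |h x| ≤ 1) ∧ (∀ x, |x| ≤ ε / 2 → h x = 0) ∧
      ∀ x, ε ≤ |x| → h x = 1 := by
  refine ⟨fun x => Real.smoothTransition (4 * (x / ε) ^ 2 - 1), ?_, fun x => ?_, fun x hx => ?_,
    fun x hx => ?_⟩
  · exact Real.smoothTransition.contDiff.comp (by fun_prop)
  · rw [abs_of_nonneg (Real.smoothTransition.nonneg _)]
    exact Real.smoothTransition.le_one _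
  · apply Real.smoothTransition.zero_of_nonpos
    have h1 : |x / ε| ≤ 1 / 2 := by
      rw [abs_div, abs_of_pos hε, div_le_iff₀ hε]
      linarith
    have h2 : (x / ε) ^ 2 ≤ (1 / 2) ^ 2 := by
      rw [← sq_abs]
      gcongr
    linarith
  · apply Real.smoothTransition.one_of_one_le
    have h1 : 1 ≤ |x / ε| := by
      rw [abs_div, abs_of_pos hε, le_div_iff₀ hε]
      linarith
    have h2 : 1 ^ 2 ≤ (x / ε) ^ 2 := by
      rw [← sq_abs (x / ε)]
      gcongr
    linarith

/-- Dividing a cut-off by `x` writes `h(A)` as `q(A) A`, which makes `A` injective on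
`ker (1 - h(A))`. -/
lemma contDiff_div_self {h : ℝ → ℝ} (hh : ContDiff ℝ 1 h) {η : ℝ} (hη : 0 < η)
    (hh0 : ∀ x, |x| ≤ η → h x = 0) : ContDiff ℝ 1 fun x => h x / x := by
  rw [contDiff_iff_contDiffAt]
  intro x
  by_cases hx : x = 0
  · have he : (fun x => h x / x) =ᶠ[𝓝 x] fun _ => 0 := by
      have hx' : |x| < η := by simpa [hx] using hη
      exact (continuous_abs.continuousAt.eventually_lt continuousAt_const hx').mono
        fun y hy => by simp [hh0 y (le_of_lt hy)]
    exact contDiffAt_const.congr_of_eventuallyEq he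
  · exact hh.contDiffAt.div contDiffAt_id hx

/-- The real part `A` is a norm limit of operators `R = f(A)`, with `f` vanishing near `0`, whose
range lies in a finite-dimensional subspace `W = ker (1 - h(A))`, where `h` is a cut-off which
is `1` on the support of `f`. -/
lemma IsSplitting.exists_finiteDimensional_approx [CompleteSpace X] (hT : IsCompactOperator T)
    (hAB : IsSplitting T A B) {δ : ℝ} (hδ : 0 < δ) :
    ∃ (R : X →L[ℂ] X) (W : Submodule ℂ X), FiniteDimensional ℂ W ∧ (∀ x ∈ W, A x ∈ W) ∧
      (∀ x ∈ W, B x ∈ W) ∧ (∀ x ∈ W, A x = 0 → x = 0) ∧ (∀ x, R x ∈ W) ∧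
      (∀ Y : X →L[ℂ] X, Commute Y A → Commute Y R) ∧ ‖R - A‖ ≤ δ := by
  obtain ⟨M₁, hM₁, K, hK⟩ := hAB.wellBounded_re.exists_bvBound
  obtain ⟨M₂, hM₂, K', hK'⟩ := hAB.wellBounded_im.exists_bvBound
  set M := max M₁ M₂ with hMdef
  have hM : 0 < M := hM₁.trans_le (le_max_left _ _)
  replace hK := hK M (le_max_left _ _)
  replace hK' := hK' M (le_max_right _ _)
  set ε := δ / (4 * (K + 1)) with hε
  have hεpos : 0 < ε := by positivity
  obtain ⟨c, hc, hmono, hcb, hid⟩ := exists_contDiff_eq_id_near_zero hεpos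
  obtain ⟨h, hh, hh1, hh0, hh2⟩ := exists_contDiff_cutoff hεpos
  have hε2 : 0 < ε / 2 := by positivity
  have hq := contDiff_div_self hh hε2 hh0
  set f : ℝ → ℝ := (fun x => (Polynomial.X : ℝ[X]).eval x) - c with hf
  have hfc : ContDiff ℝ 1 f := (Polynomial.contDiff_eval _).sub hc
  obtain ⟨R, hR⟩ := IsCalc.exists_of_contDiff hM.le hK hfc
  obtain ⟨H, hH⟩ := IsCalc.exists_of_contDiff hM.le hK hh
  obtain ⟨Q, hQ⟩ := IsCalc.exists_of_contDiff hM.le hK hq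
  have hX := IsCalc.polynomial A M Polynomial.X
  rw [realEval_X] at hX
  have hHR : H * R = R := by
    have h1 := hH.mul hM.le hR (bvOn_ne_top hh M) (bvOn_ne_top hfc M)
    have e : h * f = f := by
      ext x
      rcases le_or_gt ε |x| with hx | hx
      · simp [hh2 x hx]
      · simp [hf, hid x hx.le]
    rw [e] at h1
    exact h1.unique hK hR
  have hQA : Q * A = H := by
    have h1 := hQ.mul hM.le hX (bvOn_ne_top hq M) (bvOn_ne_top (Polynomial.contDiff_eval _) M)
    have e : ((fun x => h x / x) * fun x => (Polynomial.X : ℝ[X]).eval x) = h := by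
      ext x
      by_cases hx : x = 0
      · simp [hx, hh0 0 (by simpa using hε2.le)]
      · simp [hx]
    rw [e] at h1
    exact h1.unique hK hH
  have hHc := hAB.isCompactOperator_of_isCalc hT hM hK hK' hh hh1 hε2 hh0 hH
  have hinv : ∀ Y : X →L[ℂ] X, Commute Y A → ∀ x, H x = x → H (Y x) = Y x := fun Y hY x hx => by
    have h1 : H (Y x) = Y (H x) := (DFunLike.congr_fun (hH.commute hY).eq x).symm
    rw [h1, hx]
  refine ⟨R, LinearMap.eqLocus (H : X →ₗ[ℂ] X) LinearMap.id,
    hHc.finiteDimensional_of_apply_eq_self _ fun x => Iff.rfl, hinv A (Commute.refl A),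
    hinv B hAB.commute.symm, fun x hx hx0 => ?_, fun x => DFunLike.congr_fun hHR x,
    fun Y hY => hR.commute hY, ?_⟩
  · have h1 : H x = x := hx
    rw [← h1, ← hQA, mul_apply_eq_comp, hx0, map_zero]
  · have h1 := (hR.sub hX).enorm_le hK
    have h2 : bvOn M (f - fun x => (Polynomial.X : ℝ[X]).eval x) ≤ ENNReal.ofReal (4 * ε) := by
      have e : f - (fun x => (Polynomial.X : ℝ[X]).eval x) = -c := by
        rw [hf]
        abel
      have hcm := (hmono.monotoneOn (Set.Icc (-M) M)).eVariationOn_eq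
        (Set.left_mem_Icc.2 (by linarith)) (Set.right_mem_Icc.2 (by linarith))
      rw [Set.inter_self] at hcm
      rw [e, bvOn_neg, bvOn, hid 0 (by simpa using hεpos.le), enorm_zero, zero_add, hcm]
      apply ENNReal.ofReal_le_ofReal
      linarith [(abs_le.1 (hcb M)).2, (abs_le.1 (hcb (-M))).1]
    have h3 := h1.trans (mul_le_mul_right h2 _)
    rw [← ENNReal.ofReal_coe_nnreal, ← ENNReal.ofReal_mul K.coe_nonneg, ← ofReal_norm,
      ENNReal.ofReal_le_ofReal_iff (by positivity)] at h3
    have h4 : ε * (4 * (K + 1)) = δ := by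
      rw [hε]
      field_simp
    nlinarith

end Cutoff

section Uniqueness

open Polynomial Filter Topology

/-! ### Uniqueness of splittings of compact operators -/

variable {X : Type*} [NormedAddCommGroup X] [NormedSpace ℂ X] {A B C D T : X →L[ℂ] X}

lemma IsWellBounded.neg (hA : IsWellBounded A) : IsWellBounded (-A) := by
  obtain ⟨a, b, K, hab, h⟩ := hA
  refine ⟨-b, -a, 2 * K, by linarith, fun p => ?_⟩
  set V := eVariationOn (fun t : ℝ => p.eval (t : ℂ)) (Set.Icc (-b) (-a)) with hV
  have h1 := h (p.comp (-Polynomial.X))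
  simp only [aeval_comp, eval_comp, map_neg, aeval_X, eval_neg, eval_X] at h1
  have h2 : eVariationOn (fun t : ℝ => p.eval (-(t : ℂ))) (Set.Icc a b) ≤ V := by
    have := eVariationOn.comp_le_of_antitoneOn (fun t : ℝ => p.eval (t : ℂ))
      (s := Set.Icc (-b) (-a)) (t := Set.Icc a b) (fun t : ℝ => -t)
      (fun x _ y _ hxy => neg_le_neg hxy) (fun x hx => ⟨neg_le_neg hx.2, neg_le_neg hx.1⟩)
    refine le_trans (le_of_eq ?_) this
    congr 1
    ext t
    simp
  have h3 : ‖p.eval (-(b : ℂ))‖ₑ ≤ ‖p.eval ((-a : ℝ) : ℂ)‖ₑ + V := by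
    have h4 := eVariationOn.edist_le (fun t : ℝ => p.eval (t : ℂ)) (s := Set.Icc (-b) (-a))
      (x := -b) (y := -a) ⟨le_rfl, by linarith⟩ ⟨by linarith, le_rfl⟩
    rw [edist_eq_enorm_sub, Complex.ofReal_neg b] at h4
    refine le_trans ?_ (add_le_add_right h4 _)
    simpa using enorm_add_le (p.eval ((-a : ℝ) : ℂ)) (p.eval (-(b : ℂ)) - p.eval ((-a : ℝ) : ℂ))
  refine h1.trans ((mul_le_mul_right (add_le_add h3 h2) _).trans ?_)
  push_cast
  generalize ‖p.eval (-(a : ℂ))‖ₑ = e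
  calc K * (e + V + V) ≤ K * (e + V + V) + K * e := le_self_add
    _ = 2 * K * (e + V) := by ring

/-- Multiplication by `i` exchanges the roles of the real and imaginary parts. -/
lemma IsSplitting.mul_I (h : IsSplitting T A B) : IsSplitting (Complex.I • T) (-B) A where
  wellBounded_re := h.wellBounded_im.neg
  wellBounded_im := h.wellBounded_re
  commute := h.commute.symm.neg_left
  eq_add := by
    rw [h.eq_add, smul_add, smul_smul, Complex.I_mul_I]
    module

lemma IsSplitting.commute_re (h : IsSplitting T A B) : Commute A T := by
  rw [h.eq_add]
  exact (Commute.refl A).add_right (h.commute.smul_right _)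

/-- On a finite-dimensional invariant subspace of the eigenspace of `T = A + iB` at `μ`, the
operator `A` is diagonalisable with the only eigenvalue `Re μ`. -/
lemma IsSplitting.apply_eq_re_smul (h : IsSplitting T A B) (V : Submodule ℂ X)
    [FiniteDimensional ℂ V] (hV : ∀ x ∈ V, A x ∈ V) {μ : ℂ} (hμ : ∀ x ∈ V, T x = μ • x) :
    ∀ x ∈ V, A x = (μ.re : ℂ) • x := by
  have key : V ≤ Module.End.eigenspace (A : X →ₗ[ℂ] X) (μ.re : ℂ) := by
    refine (h.wellBounded_re.le_iSup_eigenspace V hV).trans (iSup_le fun s => ?_)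
    rintro x ⟨hxV, hx⟩
    rw [SetLike.mem_coe, Module.End.mem_eigenspace_iff, ContinuousLinearMap.coe_coe] at hx
    by_cases hx0 : x = 0
    · simp [hx0]
    have h1 : A x + Complex.I • B x = μ • x := by
      rw [← hμ x hxV, h.eq_add]
      rfl
    have h2 : B x = (-Complex.I * (μ - s)) • x := by
      have h3 : B x = (-Complex.I) • (Complex.I • B x) := by
        rw [smul_smul, neg_mul, Complex.I_mul_I, neg_neg, one_smul]
      have h4 : Complex.I • B x = μ • x - (s : ℂ) • x := by
        rw [← h1, hx]
        abel
      rw [h3, h4, ← sub_smul, smul_smul]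
    have h5 := h.wellBounded_im.im_eq_zero_of_eigenvector hx0 h2
    have h6 : μ.re = s := by
      simp at h5
      linarith
    rw [Module.End.mem_eigenspace_iff, ContinuousLinearMap.coe_coe, hx, h6]
  exact fun x hx => Module.End.mem_eigenspace_iff.1 (key hx)

lemma IsCompactOperator.finiteDimensional_eigenspace (hT : IsCompactOperator T) {μ : ℂ}
    (hμ : μ ≠ 0) : FiniteDimensional ℂ (Module.End.eigenspace (T : X →ₗ[ℂ] X) μ) := by
  have h : IsCompactOperator (μ⁻¹ • T) := hT.smul μ⁻¹
  refine h.finiteDimensional_of_apply_eq_self _ fun x => ?_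
  rw [Module.End.mem_eigenspace_iff, ContinuousLinearMap.coe_coe, smul_apply,
    inv_smul_eq_iff₀ hμ]

/-- Two splittings of a compact operator agree on its eigenvectors at non-zero eigenvalues. -/
lemma IsSplitting.apply_eq_apply_of_eigenvector (hT : IsCompactOperator T)
    (hAB : IsSplitting T A B) (hCD : IsSplitting T C D) {μ : ℂ} (hμ : μ ≠ 0) {x : X}
    (hx : T x = μ • x) : A x = C x := by
  set V := Module.End.eigenspace (T : X →ₗ[ℂ] X) μ with hV
  have := hT.finiteDimensional_eigenspace hμ
  have hinv : ∀ Y : X →L[ℂ] X, Commute Y T → ∀ x ∈ V, Y x ∈ V := fun Y hY x hx => by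
    rw [hV, Module.End.mem_eigenspace_iff, ContinuousLinearMap.coe_coe] at hx ⊢
    rw [← mul_apply_eq_comp, ← hY.eq, mul_apply_eq_comp, hx, map_smul]
  have heig : ∀ x ∈ V, T x = μ • x := fun x hx => Module.End.mem_eigenspace_iff.1 hx
  have hxV : x ∈ V := Module.End.mem_eigenspace_iff.2 hx
  rw [hAB.apply_eq_re_smul V (hinv A hAB.commute_re) heig x hxV,
    hCD.apply_eq_re_smul V (hinv C hCD.commute_re) heig x hxV]

lemma mul_eq_zero_of_forall_exists_approx_right {Y A : X →L[ℂ] X}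
    (h : ∀ δ > 0, ∃ R : X →L[ℂ] X, Y * R = 0 ∧ ‖R - A‖ ≤ δ) : Y * A = 0 := by
  rw [← norm_le_zero_iff]
  refine le_of_forall_pos_le_add fun ε hε => ?_
  obtain ⟨R, hR, hRA⟩ := h (ε / (‖Y‖ + 1)) (by positivity)
  have e : Y * A = -(Y * (R - A)) := by rw [mul_sub, hR]; abel
  rw [e, norm_neg, zero_add]
  calc ‖Y * (R - A)‖ ≤ ‖Y‖ * ‖R - A‖ := norm_mul_le _ _
    _ ≤ (‖Y‖ + 1) * (ε / (‖Y‖ + 1)) := by gcongr; linarith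
    _ = ε := by field_simp

lemma mul_eq_zero_of_forall_exists_approx_left {Y A : X →L[ℂ] X}
    (h : ∀ δ > 0, ∃ R : X →L[ℂ] X, R * Y = 0 ∧ ‖R - A‖ ≤ δ) : A * Y = 0 := by
  rw [← norm_le_zero_iff]
  refine le_of_forall_pos_le_add fun ε hε => ?_
  obtain ⟨R, hR, hRA⟩ := h (ε / (‖Y‖ + 1)) (by positivity)
  have e : A * Y = -((R - A) * Y) := by rw [sub_mul, hR]; abel
  rw [e, norm_neg, zero_add]
  calc ‖(R - A) * Y‖ ≤ ‖R - A‖ * ‖Y‖ := norm_mul_le _ _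
    _ ≤ (ε / (‖Y‖ + 1)) * (‖Y‖ + 1) := by gcongr; linarith
    _ = ε := by field_simp

/-- The operator `A` is a limit of operators whose ranges are spanned by joint eigenvectors of `A` and
`B` at non-zero eigenvalues of `T`, and `A = C` on these. -/
lemma IsSplitting.sub_mul_eq_zero [CompleteSpace X] (hT : IsCompactOperator T)
    (hAB : IsSplitting T A B) (hCD : IsSplitting T C D) : (A - C) * A = 0 := by
  refine mul_eq_zero_of_forall_exists_approx_right fun δ hδ => ?_
  obtain ⟨R, W, hW, hWA, hWB, hW0, hR, -, hRA⟩ := hAB.exists_finiteDimensional_approx hT hδ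
  refine ⟨R, ?_, hRA⟩
  have key : W ≤ LinearMap.ker ((A - C : X →L[ℂ] X) : X →ₗ[ℂ] X) := by
    refine (hAB.wellBounded_re.le_iSup_eigenspace W hWA).trans (iSup_le fun s => ?_)
    set V := W ⊓ Module.End.eigenspace (A : X →ₗ[ℂ] X) (s : ℂ) with hV
    have : FiniteDimensional ℂ V := Submodule.finiteDimensional_inf_left _ _
    have hVB : ∀ x ∈ V, B x ∈ V := by
      rintro x ⟨hxW, hx⟩
      refine ⟨hWB x hxW, ?_⟩
      rw [SetLike.mem_coe, Module.End.mem_eigenspace_iff, ContinuousLinearMap.coe_coe] at hx ⊢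
      rw [← mul_apply_eq_comp, hAB.commute.eq, mul_apply_eq_comp, hx, map_smul]
    refine (hAB.wellBounded_im.le_iSup_eigenspace V hVB).trans (iSup_le fun t => ?_)
    rintro x ⟨⟨hxW, hxA⟩, hxB⟩
    rw [SetLike.mem_coe, Module.End.mem_eigenspace_iff, ContinuousLinearMap.coe_coe] at hxA hxB
    rw [LinearMap.mem_ker, ContinuousLinearMap.coe_coe, sub_apply, sub_eq_zero]
    by_cases hx0 : x = 0
    · simp [hx0]
    have hμ : (s : ℂ) + Complex.I * t ≠ 0 := fun h0 => by
      have hs : s = 0 := by simpa using congrArg Complex.re h0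
      exact hx0 (hW0 x hxW (by simpa [hs] using hxA))
    refine hAB.apply_eq_apply_of_eigenvector hT hCD hμ ?_
    rw [hAB.eq_add, add_apply, smul_apply, hxA, hxB, smul_smul, add_smul]
  ext x
  exact LinearMap.mem_ker.1 (key (hR x))

/-- The difference `A - C` annihilates `A` and `B` from the right, hence commutes with `T` and has
`T (A - C) = 0`. An approximation `R` of `A` then maps the range of `A - C` into a
finite-dimensional part of the kernel of `T`, on which `A` is both zero and injective. -/
lemma IsSplitting.mul_sub_eq_zero [CompleteSpace X] (hT : IsCompactOperator T)
    (hAB : IsSplitting T A B) (hCD : IsSplitting T C D) : A * (A - C) = 0 := by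
  have hNA := hAB.sub_mul_eq_zero hT hCD
  have hN : A - C = Complex.I • (D - B) := by
    have h := hAB.eq_add.symm.trans hCD.eq_add
    rw [smul_sub, sub_eq_sub_iff_add_eq_add, h, add_comm]
  have hNB : (A - C) * B = 0 := by
    have h := hAB.mul_I.sub_mul_eq_zero (hT.smul Complex.I) hCD.mul_I
    rw [mul_neg, neg_eq_zero, neg_sub_neg] at h
    rw [hN, smul_mul_assoc, h, smul_zero]
  have hNT : (A - C) * T = 0 := by
    rw [hAB.eq_add, mul_add, mul_smul_comm, hNA, hNB, smul_zero, add_zero]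
  have hTN : T * (A - C) = 0 := by
    rw [← (hAB.commute_re.sub_left hCD.commute_re).eq, hNT]
  refine mul_eq_zero_of_forall_exists_approx_left fun δ hδ => ?_
  obtain ⟨R, W, hW, hWA, hWB, hW0, hR, hRc, hRA⟩ := hAB.exists_finiteDimensional_approx hT hδ
  refine ⟨R, ?_, hRA⟩
  set V := W ⊓ LinearMap.ker (T : X →ₗ[ℂ] X) with hV
  have : FiniteDimensional ℂ V := Submodule.finiteDimensional_inf_left _ _
  have hVA : ∀ x ∈ V, A x ∈ V := by
    rintro x ⟨hxW, hx⟩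
    refine ⟨hWA x hxW, ?_⟩
    rw [SetLike.mem_coe, LinearMap.mem_ker, ContinuousLinearMap.coe_coe] at hx ⊢
    rw [← mul_apply_eq_comp, ← hAB.commute_re.eq, mul_apply_eq_comp, hx, map_zero]
  have hA0 := hAB.apply_eq_re_smul V hVA (μ := 0) fun x hx => by
    rw [zero_smul]
    exact LinearMap.mem_ker.1 hx.2
  ext x
  rw [mul_apply_eq_comp]
  have hmem : R ((A - C) x) ∈ V := by
    refine ⟨hR _, ?_⟩
    rw [SetLike.mem_coe, LinearMap.mem_ker, ContinuousLinearMap.coe_coe, ← mul_apply_eq_comp,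
      (hRc T hAB.commute_re.symm).eq, mul_apply_eq_comp, ← mul_apply_eq_comp T, hTN]
    simp
  exact hW0 _ hmem.1 (by simpa using hA0 _ hmem)

/-- If `A` and `C` differ only in their first powers, then `p(A) - p(C)` is its linear term. -/
lemma realEval_sub_realEval (h : ∀ k : ℕ, A ^ (k + 2) = C ^ (k + 2)) (p : ℝ[X]) :
    realEval A p - realEval C p = (((derivative p).eval 0 : ℝ) : ℂ) • (A - C) := by
  induction p using Polynomial.induction_on' with
  | add p q hp hq =>
    rw [map_add, map_add, add_sub_add_comm, hp, hq, derivative_add, eval_add, Complex.ofReal_add,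
      add_smul]
  | monomial n r =>
    rw [← C_mul_X_pow_eq_monomial]
    match n with
    | 0 => simp
    | 1 => simp [Algebra.algebraMap_eq_smul_one, smul_sub]
    | k + 2 => simp [h k]

/-- A compact operator has at most one splitting. -/
lemma IsSplitting.unique [CompleteSpace X] (hT : IsCompactOperator T)
    (hAB : IsSplitting T A B) (hCD : IsSplitting T C D) : A = C ∧ B = D := by
  have h1 := hAB.sub_mul_eq_zero hT hCD
  have h2 := hAB.mul_sub_eq_zero hT hCD
  have h3 := hCD.sub_mul_eq_zero hT hAB
  rw [sub_mul, sub_eq_zero] at h1 h3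
  rw [mul_sub, sub_eq_zero] at h2
  -- Now `A² = CA = AC = C²`.
  have hpow : ∀ k : ℕ, A ^ (k + 2) = C ^ (k + 2) := by
    have hsq : A * A = C * C := by rw [h3, h2]
    intro k
    induction k with
    | zero => rw [zero_add, pow_two, pow_two, hsq]
    | succ k ih =>
      rw [pow_succ A, ih, show k + 2 = (k + 1) + 1 from rfl, pow_succ C (k + 1), mul_assoc, ← h1,
        hsq, pow_succ C (k + 1 + 1), pow_succ C (k + 1), mul_assoc]
  have hAC : A = C := by
    obtain ⟨M₁, hM₁, K, hK⟩ := hAB.wellBounded_re.exists_bvBound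
    obtain ⟨M₂, hM₂, K', hK'⟩ := hCD.wellBounded_re.exists_bvBound
    set M := max M₁ M₂ with hMdef
    have hM : 0 < M := hM₁.trans_le (le_max_left _ _)
    rw [← sub_eq_zero, ← norm_le_zero_iff]
    refine le_of_forall_pos_le_add fun ε hε => ?_
    have hδ : 0 < ε / (2 * (K + K' + 1)) := by positivity
    obtain ⟨p, hp, hp'⟩ := exists_polynomial_slope (M := M) (s := 0) (by simpa using hM.le) hδ
    have h5 := (hK M (le_max_left _ _)).norm_le p hδ.le hp'
    have h6 := (hK' M (le_max_right _ _)).norm_le p hδ.le hp'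
    have h7 := congrArg norm (realEval_sub_realEval hpow p)
    rw [norm_smul, Complex.norm_real, Real.norm_eq_abs] at h7
    have h8 : 1 / 2 * ‖A - C‖ ≤ |(derivative p).eval 0| * ‖A - C‖ := by gcongr
    have h9 := norm_sub_le (realEval A p) (realEval C p)
    have h10 : ε / (2 * (K + K' + 1)) * (2 * (K + K' + 1)) = ε := by field_simp
    nlinarith
  refine ⟨hAC, ?_⟩
  have h := hAB.eq_add.symm.trans hCD.eq_add
  rw [hAC, add_right_inj] at h
  exact smul_right_injective _ Complex.I_ne_zero h

end Uniqueness

/-! ### The splitting given by the `AC(σ)` functional calculus -/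

/-- The real coordinate function `z ↦ Re (w z)` on `σ`. -/
def reCoord (σ : Set ℂ) (w : ℂ) : σ → ℂ := fun z => ((w * z).re : ℝ)

lemma IsCompact.exists_re_mem_Icc {σ : Set ℂ} (hσ : IsCompact σ) (w : ℂ) :
    ∃ a b : ℝ, a ≤ b ∧ ∀ z ∈ σ, (w * z).re ∈ Set.Icc a b := by
  obtain ⟨r, hr⟩ := hσ.exists_bound_of_continuousOn (f := fun z => w * z) (by fun_prop)
  exact ⟨-|r|, |r|, neg_le_self (abs_nonneg r), fun z hz =>
    abs_le.1 (((Complex.abs_re_le_norm _).trans (hr z hz)).trans (le_abs_self r))⟩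

lemma bvNorm_comp_re_le {σ : Set ℂ} (f : ℝ → ℂ) (w : ℂ) {a b : ℝ} (hle : a ≤ b)
    (hab : ∀ z ∈ σ, (w * z).re ∈ Set.Icc a b) :
    bvNorm (fun z : σ => f (w * z).re) ≤ ‖f b‖ₑ + 2 * eVariationOn f (Set.Icc a b) := by
  rw [two_mul, ← add_assoc]
  refine add_le_add (iSup_le fun z => ?_) (planeVariation_comp_re_le f w hab)
  have h := eVariationOn.edist_le f (hab z z.2) (Set.right_mem_Icc.2 hle)
  rw [edist_eq_enorm_sub] at h
  refine le_trans ?_ (add_le_add_right h _)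
  simpa using enorm_add_le (f b) (f (w * z).re - f b)

lemma reCoord_mem_AC {σ : Set ℂ} (hσ : IsCompact σ) (w : ℂ) : reCoord σ w ∈ AC σ := by
  refine ⟨?_, fun ε hε => ⟨reCoord σ w, ?_, by rwa [sub_self, bvNorm_zero]⟩⟩
  · obtain ⟨a, b, hle, hab⟩ := hσ.exists_re_mem_Icc w
    refine ne_top_of_le_ne_top ?_ (bvNorm_comp_re_le (fun t : ℝ => (t : ℂ)) w hle hab)
    have h := (Complex.isometry_ofReal.lipschitz.lipschitzOnWith
      (s := Set.univ)).comp_eVariationOn_le (g := id) (s := Set.Icc a b) (Set.mapsTo_univ _ _)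
    rw [eVariationOn_id_Icc] at h
    refine ENNReal.add_ne_top.2 ⟨enorm_ne_top, ENNReal.mul_ne_top ENNReal.ofNat_ne_top
      (ne_top_of_le_ne_top (by finiteness) h)⟩
  · have e : reCoord σ w = (w / 2) • (fun z : σ => (z : ℂ)) +
        ((starRingEnd ℂ) w / 2) • (fun z : σ => (starRingEnd ℂ) (z : ℂ)) := by
      ext z
      simp only [reCoord, Pi.add_apply, Pi.smul_apply, smul_eq_mul, Complex.re_eq_add_conj, map_mul]
      ring
    rw [e]
    exact add_mem (Subalgebra.smul_mem _ (Algebra.subset_adjoin (by simp)) _)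
      (Subalgebra.smul_mem _ (Algebra.subset_adjoin (by simp)) _)

lemma isWellBounded_apply_reCoord {X : Type*} [NormedAddCommGroup X] [NormedSpace ℂ X]
    {σ : Set ℂ} (hσ : IsCompact σ) (Ψ : AC σ →ₐ[ℂ] (X →L[ℂ] X)) {K : ℝ≥0}
    (hK : ∀ f : AC σ, ‖Ψ f‖ₑ ≤ K * bvNorm (f : σ → ℂ)) (w : ℂ) :
    IsWellBounded (Ψ ⟨reCoord σ w, reCoord_mem_AC hσ w⟩) := by
  obtain ⟨a, b, hle, hab⟩ := hσ.exists_re_mem_Icc w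
  refine ⟨a, b, 2 * K, hle, fun p => ?_⟩
  rw [Polynomial.aeval_algHom_apply]
  refine (hK _).trans ?_
  have e : ((Polynomial.aeval (⟨reCoord σ w, reCoord_mem_AC hσ w⟩ : AC σ) p : AC σ) : σ → ℂ) =
      fun z : σ => (fun t : ℝ => p.eval (t : ℂ)) (w * z).re := by
    ext z
    rw [Polynomial.aeval_subalgebra_coe, Polynomial.aeval_fn_apply]
    simp [reCoord]
  rw [e]
  refine (mul_le_mul_right (bvNorm_comp_re_le (fun t : ℝ => p.eval (t : ℂ)) w hle hab) _).trans ?_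
  push_cast
  generalize eVariationOn (fun t : ℝ => p.eval (t : ℂ)) (Set.Icc a b) = V
  calc K * (‖p.eval (b : ℂ)‖ₑ + 2 * V) ≤ K * (‖p.eval (b : ℂ)‖ₑ + 2 * V) +
        K * ‖p.eval (b : ℂ)‖ₑ := le_self_add
    _ = 2 * K * (‖p.eval (b : ℂ)‖ₑ + V) := by ring

theorem mainTheorem2 {X : Type*} [NormedAddCommGroup X] [NormedSpace ℂ X] [CompleteSpace X]
    (σ : Set ℂ) (hσ : IsCompact σ) (hσne : σ.Nonempty)
    (T : X →L[ℂ] X) (hT : IsCompactOperator T) (hTAC : IsACOperator σ T)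
    (A B : X →L[ℂ] X) (hAB : IsSplitting T A B)
    (α β : ℝ) (ω : ℂ) (hω : ω = (α : ℂ) + (β : ℂ) * Complex.I) :
    IsSplitting (ω • T) ((α : ℂ) • A - (β : ℂ) • B) ((α : ℂ) • B + (β : ℂ) • A) ∧
    ∀ U V : X →L[ℂ] X, IsSplitting (ω • T) U V →
      U = (α : ℂ) • A - (β : ℂ) • B ∧ V = (α : ℂ) • B + (β : ℂ) • A := by
  obtain ⟨Ψ, ⟨K, hK⟩, idσ, hid, rfl⟩ := hTAC
  set R : ℂ → AC σ := fun w => ⟨reCoord σ w, reCoord_mem_AC hσ w⟩ with hR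
  have hcomm : ∀ f g : AC σ, Commute (Ψ f) (Ψ g) := fun f g => by
    rw [commute_iff_eq, ← map_mul, mul_comm, map_mul]
  -- Uniqueness identifies `A` and `B` with the images of the two coordinate functions.
  have hsplit : IsSplitting (Ψ idσ) (Ψ (R 1)) (Ψ (R (-Complex.I))) := by
    refine ⟨isWellBounded_apply_reCoord hσ Ψ hK _, isWellBounded_apply_reCoord hσ Ψ hK _,
      hcomm _ _, ?_⟩
    rw [← map_smul, ← map_add]
    congr 1
    refine Subtype.ext (funext fun z => ?_)
    rw [hid]
    simp [hR, reCoord, mul_comm Complex.I, Complex.re_add_im]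
  obtain ⟨rfl, rfl⟩ := hAB.unique hT hsplit
  have hre : (α : ℂ) • Ψ (R 1) - (β : ℂ) • Ψ (R (-Complex.I)) = Ψ (R ω) := by
    rw [← map_smul, ← map_smul, ← map_sub]
    congr 1
    refine Subtype.ext (funext fun z => ?_)
    simp [hR, reCoord, hω]
  have him : (α : ℂ) • Ψ (R (-Complex.I)) + (β : ℂ) • Ψ (R 1) = Ψ (R (-Complex.I * ω)) := by
    rw [← map_smul, ← map_smul, ← map_add]
    congr 1
    refine Subtype.ext (funext fun z => ?_)
    simp [hR, reCoord, hω]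
  have hmain : IsSplitting (ω • Ψ idσ) ((α : ℂ) • Ψ (R 1) - (β : ℂ) • Ψ (R (-Complex.I)))
      ((α : ℂ) • Ψ (R (-Complex.I)) + (β : ℂ) • Ψ (R 1)) := by
    refine ⟨?_, ?_, ?_, ?_⟩
    · rw [hre]
      exact isWellBounded_apply_reCoord hσ Ψ hK ω
    · rw [him]
      exact isWellBounded_apply_reCoord hσ Ψ hK _
    · rw [hre, him]
      exact hcomm _ _
    · rw [hsplit.eq_add, hω]
      simp only [smul_add, add_smul, smul_smul]
      have hI : ((α : ℂ) + β * Complex.I) * Complex.I = Complex.I * α - β := by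
        linear_combination (β : ℂ) * Complex.I_mul_I
      rw [hI]
      module
  exact ⟨hmain, fun U V hUV => hUV.unique (hT.smul ω) hmain⟩
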